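/- For $0<\alpha\le 1$ and positive integers $n_1<n_2<\dots<n_k$, write $(m,n)$ for the greatest common divisor of $m$ and $n$, and let $$\Lambda_\alpha(n_1,\dots,n_k)=\sup_{\sum_{i\le k}|c_i|^2=1}\ \Big|\sum_{i,j\le k}\frac{(n_i,n_j)^{2\alpha}}{(n_in_j)^{\alpha}}\,c_i\overline{c_j}\Big|$$ be the spectral norm of the GCD matrix $\big((n_i,n_j)^{2\alpha}/(n_in_j)^{\alpha}\big)_{i,j\le k}$, the supremum being over complex vectors $(c_1,\dots,c_k)$. Let $\gamma$ denote Euler's constant. 1. For $\alpha=1$, as $k\to\infty$, $$\Lambda_1(n_1,\dots,n_k)\le\Big(\frac{6e^{2\gamma}}{\pi^2}+o(1)\Big)(\log\log k)^2,$$ where the $o(1)$ depends only on $k$ (it is uniform in $n_1<\dots<n_k$). 2. There are constants $C(\alpha)>0$, depending only on $\alpha$, such that for all $k\ge 3$ and all positive integers $n_1<\dots<n_k$: for $\tfrac12<\alpha<1$, $$\Lambda_\alpha(n_1,\dots,n_k)\le\exp\Big(2C(\alpha)\frac{(\log k)^{1-\alpha}}{(\log\log k)^{\alpha}}\Big),$$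 and for $0<\alpha\le\tfrac12$, $$\Lambda_\alpha(n_1,\dots,n_k)\le k^{1-2\alpha}\exp\Big(2C(\alpha)\sqrt{\log k\,\log\log k}\Big).$$ -/

import Mathlib

open Filter Topology

/-- The GCD matrix of exponent `α` attached to `n_1, …, n_k`: its `(i, j)` entry is
`(n_i, n_j)^(2α) / (n_i n_j)^α`. -/
noncomputable def gcdMatrix {k : ℕ} (α : ℝ) (n : Fin k → ℕ) : Matrix (Fin k) (Fin k) ℝ :=
  fun i j => (Nat.gcd (n i) (n j) : ℝ) ^ (2 * α) / ((n i : ℝ) * (n j : ℝ)) ^ α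

/-- The GCD form `∑_{i,j ≤ k} (n_i, n_j)^(2α) / (n_i n_j)^α · c_i · conj c_j`. -/
noncomputable def gcdForm {k : ℕ} (α : ℝ) (n : Fin k → ℕ) (c : EuclideanSpace ℂ (Fin k)) : ℂ :=
  ∑ i, ∑ j, (gcdMatrix α n i j : ℂ) * c i * (starRingEnd ℂ) (c j)

/-- The spectral norm: the supremum of the absolute value of the GCD form over all vectors of
`ℓ²`-norm one (the form is real-valued, see `gcdForm_im`). -/
noncomputable def gcdSpectralNorm {k : ℕ} (α : ℝ) (n : Fin k → ℕ) : ℝ :=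
  sSup {x : ℝ | ∃ c : EuclideanSpace ℂ (Fin k), ‖c‖ = 1 ∧ x = ‖gcdForm α n c‖}

/-- The GCD form takes real values. -/
theorem gcdForm_im {k : ℕ} (α : ℝ) (n : Fin k → ℕ) (c : EuclideanSpace ℂ (Fin k)) :
    (gcdForm α n c).im = 0 := by
  rw [← Complex.conj_eq_iff_im]
  unfold gcdForm
  simp only [map_sum, map_mul, Complex.conj_ofReal, Complex.conj_conj]
  rw [Finset.sum_comm]
  refine Finset.sum_congr rfl fun i _ => Finset.sum_congr rfl fun j _ => ?_
  have h : gcdMatrix α n j i = gcdMatrix α n i j := by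
    unfold gcdMatrix
    rw [Nat.gcd_comm, mul_comm (n j : ℝ)]
  rw [h]
  ring

/-- The set whose supremum is the spectral norm is bounded above. -/
theorem gcdSpectralNorm_bddAbove {k : ℕ} (α : ℝ) (n : Fin k → ℕ) :
    BddAbove {x : ℝ | ∃ c : EuclideanSpace ℂ (Fin k), ‖c‖ = 1 ∧ x = ‖gcdForm α n c‖} := by
  refine ⟨∑ i, ∑ j, |gcdMatrix α n i j|, ?_⟩
  rintro x ⟨c, hc, rfl⟩
  have hle : ∀ i, ‖c i‖ ≤ 1 := fun i => (PiLp.norm_apply_le c i).trans hc.le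
  refine (norm_sum_le _ _).trans (Finset.sum_le_sum fun i _ => ?_)
  refine (norm_sum_le _ _).trans (Finset.sum_le_sum fun j _ => ?_)
  rw [norm_mul, norm_mul, Complex.norm_real, Real.norm_eq_abs, RCLike.norm_conj, mul_assoc]
  exact mul_le_of_le_one_right (abs_nonneg _)
    (mul_le_one₀ (hle i) (norm_nonneg _) (hle j))

/-- Every value of the GCD form at a unit vector is at most the spectral norm. -/
theorem gcdForm_re_le_gcdSpectralNorm {k : ℕ} (α : ℝ) (n : Fin k → ℕ)
    (c : EuclideanSpace ℂ (Fin k)) (hc : ‖c‖ = 1) :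
    (gcdForm α n c).re ≤ gcdSpectralNorm α n :=
  (Complex.re_le_norm _).trans (le_csSup (gcdSpectralNorm_bddAbove α n) ⟨c, hc, rfl⟩)

/-! Each matrix entry factors over primes as `∏ p, (p^(-α))^|a_p - b_p|`, where `a_p`, `b_p` are the
exponents of `p` in the two integers. The number `r^|a|` is the `a`-th Fourier coefficient of the
Poisson kernel of radius `r`. With one circle for each prime (Bohr lift), the form is therefore `∫ P
|D|²` on a torus, where `P` is the product of the Poisson kernels of radii `p^(-α)` and `D` is a
trigonometric polynomial with `k` distinct characters (`gcdForm_eq_integral`). For a unit vector, `∫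
|D|² = 1` and `|D|² ≤ k`, so convexity gives `Λ ≤ (k ∫ P^l)^(1/l)` for every `l ≥ 1`
(`gcdSpectralNorm_le_of_moment`).

The moment `∫ P^l` is a product over primes. One circle contributes at most `((1+r)/(1-r))^l`, and
also at most `(1-r²)^(-l²)`; the first bound serves small primes, the second large ones. Cutting at
`y` gives (`exists_gcdSpectralNorm_le_exp`) `log Λ ≤ log k / l + ∑_{p ≤ y}
log((1+p^(-α))/(1-p^(-α))) + l ∑_{p > y} -log(1-p^(-2α))`.

With `L = log k`, the choices are as follows. For `1/2 < α < 1`, taking `y ≈ L log L` and `l ≈ y^α`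
makes the three terms comparable, by Chebyshev's bounds. For `α = 1`, taking `y` of size at least
about `L (log L)²` and `l ≈ L log L` makes the outer terms vanish in the limit; the middle one is
`log ∏ (1-p^(-2))(1-1/p)^(-2)`, which yields `1/ζ(2) = 6/π²` and, by Mertens' product theorem,
`e^(2γ) (log log k)²`. For `α ≤ 1/2`, the bound is applied slightly above `1/2` with no small primes
and then interpolated with exponent `0`, where every entry is `1` and the norm is at most `k`. -/

/-! ### Poisson kernels on the circle: Fourier coefficients and moments. -/

open MeasureTheory AddCircle in
theorem integral_fourier_haar (a : ℤ) :
    ∫ x : AddCircle (1 : ℝ), (fourier a x : ℂ) ∂haarAddCircle = if a = 0 then 1 else 0 := by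
  have h := (orthonormal_iff_ite.mp (orthonormal_fourier (T := (1 : ℝ)))) 0 a
  rw [ContinuousMap.inner_toLp (haarAddCircle (T := (1 : ℝ))) (fourier 0) (fourier a)] at h
  simpa [eq_comm] using h

/-- Compares the squared coefficients of `(1-z)^(-(l+1))` with the coefficients of
`(1-z)^(-(l+1)²)`. Both start at `1`, and the ratios of consecutive terms compare because `(m+1+l)²
≤ (m+1)(m+1+l²+2l)`. -/
theorem choose_sq_le_choose (l m : ℕ) :
    ((m + l).choose l) ^ 2 ≤ (m + ((l + 1) ^ 2 - 1)).choose ((l + 1) ^ 2 - 1) := by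
  induction m with
  | zero => simp
  | succ m ih =>
    obtain ⟨q, hq⟩ : ∃ q, (l + 1) ^ 2 = q + 1 := ⟨l ^ 2 + 2 * l, by ring⟩
    have e (j : ℕ) : (m + 1) * (m + 1 + j).choose j = (m + 1 + j) * (m + j).choose j := by
      have h1 := Nat.add_one_mul_choose_eq (m + j) m
      have h2 : (m + j).choose m = (m + j).choose j := Nat.choose_symm_add
      have h3 : (m + j + 1).choose (m + 1) = (m + 1 + j).choose j := by
        rw [show m + j + 1 = m + 1 + j by ring]; exact Nat.choose_symm_add
      rw [h2, h3] at h1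
      linarith
    rw [hq, Nat.add_sub_cancel] at ih ⊢
    have h1 := e l
    have h2 := e q
    refine Nat.le_of_mul_le_mul_left (c := (m + 1) ^ 2) ?_ (by positivity)
    calc (m + 1) ^ 2 * (m + 1 + l).choose l ^ 2
        = (m + 1 + l) ^ 2 * (m + l).choose l ^ 2 := by rw [← mul_pow, h1, mul_pow]
      _ ≤ ((m + 1) * (m + 1 + q)) * (m + q).choose q := by
          refine Nat.mul_le_mul ?_ ih
          nlinarith [Nat.zero_le (m * l ^ 2)]
      _ = (m + 1) ^ 2 * (m + 1 + q).choose q := by rw [mul_assoc, ← h2]; ring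

theorem norm_fourier_apply (j : ℤ) (x : AddCircle (1 : ℝ)) : ‖(fourier j x : ℂ)‖ = 1 := by
  rw [fourier_apply, Circle.norm_coe]

theorem fourier_natCast_eq_pow (m : ℕ) (x : AddCircle (1 : ℝ)) :
    (fourier (m : ℤ) x : ℂ) = fourier 1 x ^ m := by
  rw [fourier_apply, fourier_one, AddCircle.toCircle_zsmul, zpow_natCast, Circle.coe_pow]

theorem norm_mul_fourier_one (r : ℝ) (x : AddCircle (1 : ℝ)) :
    ‖(r : ℂ) * fourier 1 x‖ = |r| := by
  rw [norm_mul, norm_fourier_apply, mul_one, Complex.norm_real, Real.norm_eq_abs]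

/-- The Poisson kernel of the unit disc at radius `r`, as a function on the circle. -/
noncomputable def circlePoisson (r : ℝ) (x : AddCircle (1 : ℝ)) : ℝ :=
  (1 - r ^ 2) / ‖1 - (r : ℂ) * fourier 1 x‖ ^ 2

open MeasureTheory AddCircle in
/-- Fourier coefficients of the squared modulus of an absolutely convergent power series. -/
theorem integral_normSq_mul_fourier (b : ℕ → ℝ) (hb : Summable fun m => |b m|)
    (f : AddCircle (1 : ℝ) → ℂ)
    (hf : ∀ x, HasSum (fun m : ℕ => (b m : ℂ) * fourier (m : ℤ) x) (f x)) (a : ℕ) :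
    ∫ x, ((‖f x‖ ^ 2 : ℝ) : ℂ) * fourier (a : ℤ) x ∂haarAddCircle
      = ∑' m, (b m : ℂ) * (b (m + a) : ℂ) := by
  have hn (x : AddCircle (1 : ℝ)) (j : ℤ) : ‖(fourier j x : ℂ)‖ = 1 := norm_fourier_apply j x
  have hs (x : AddCircle (1 : ℝ)) : Summable fun m : ℕ => ‖(b m : ℂ) * fourier (m : ℤ) x‖ := by
    simpa only [norm_mul, hn, mul_one, Complex.norm_real, Real.norm_eq_abs] using hb
  have hprod (x : AddCircle (1 : ℝ)) : HasSum (fun q : ℕ × ℕ => (b q.1 : ℂ) * (b q.2 : ℂ) *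
      fourier ((q.1 : ℤ) - q.2 + a) x) (((‖f x‖ ^ 2 : ℝ) : ℂ) * fourier (a : ℤ) x) := by
    have hc : HasSum (fun m : ℕ => (starRingEnd ℂ) ((b m : ℂ) * fourier (m : ℤ) x))
        ((starRingEnd ℂ) (f x)) := by
      simpa using (hf x).mapL (Complex.conjCLE : ℂ →L[ℝ] ℂ)
    have hsc : Summable fun m : ℕ => ‖(starRingEnd ℂ) ((b m : ℂ) * fourier (m : ℤ) x)‖ := by
      simpa only [RCLike.norm_conj] using hs x
    have h := (summable_mul_of_summable_norm (hs x) hsc)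
    have h1 := ((hf x).mul hc h).mul_right (fourier (a : ℤ) x : ℂ)
    rw [Complex.mul_conj, Complex.normSq_eq_norm_sq] at h1
    refine h1.congr_fun fun q => ?_
    rw [fourier_add, sub_eq_add_neg, fourier_add, fourier_neg]
    simp
    ring
  have hsum2 : Summable fun q : ℕ × ℕ => |b q.1| * |b q.2| :=
    hb.mul_of_nonneg hb (fun _ => abs_nonneg _) (fun _ => abs_nonneg _)
  have hint := hasSum_integral_of_dominated_convergence
    (μ := haarAddCircle (T := (1 : ℝ)))
    (F := fun (q : ℕ × ℕ) x => (b q.1 : ℂ) * (b q.2 : ℂ) * fourier ((q.1 : ℤ) - q.2 + a) x)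
    (f := fun x => ((‖f x‖ ^ 2 : ℝ) : ℂ) * fourier (a : ℤ) x)
    (fun q _ => |b q.1| * |b q.2|)
    (fun q => (by fun_prop : Continuous _).aestronglyMeasurable)
    (fun q => Eventually.of_forall fun x => by
      rw [norm_mul, norm_mul, hn, mul_one, Complex.norm_real, Complex.norm_real,
        Real.norm_eq_abs, Real.norm_eq_abs])
    (Eventually.of_forall fun x => hsum2)
    (integrable_const _)
    (Eventually.of_forall hprod)
  simp_rw [integral_const_mul, integral_fourier_haar] at hint
  rw [← hint.tsum_eq]
  -- By orthogonality only the pairs `(m, m + a)` survive in the double series.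
  have hinj : Function.Injective (fun m : ℕ => ((m, m + a) : ℕ × ℕ)) := fun m m' h => by
    simpa using congrArg Prod.fst h
  rw [← hinj.tsum_eq]
  · refine tsum_congr fun m => ?_
    simp
  · rintro ⟨m, m'⟩ h
    simp only [Function.mem_support, ne_eq, mul_eq_zero, not_or] at h
    have : ((m : ℤ) - m' + a) = 0 := by
      by_contra h'
      simp [h'] at h
    exact ⟨m, by simp; omega⟩

theorem one_sub_mul_fourier_ne_zero {r : ℝ} (h0 : 0 ≤ r) (h1 : r < 1) (x : AddCircle (1 : ℝ)) :
    1 - (r : ℂ) * fourier 1 x ≠ 0 := by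
  intro h
  have : ‖(r : ℂ) * fourier 1 x‖ = 1 := by rw [← sub_eq_zero.mp h]; simp
  rw [norm_mul, norm_fourier_apply, Complex.norm_real, Real.norm_of_nonneg h0] at this
  linarith

theorem continuous_circlePoisson {r : ℝ} (h0 : 0 ≤ r) (h1 : r < 1) :
    Continuous (circlePoisson r) := by
  unfold circlePoisson
  refine Continuous.div (by fun_prop) (by fun_prop) fun x => ?_
  have := one_sub_mul_fourier_ne_zero h0 h1 x
  positivity

theorem circlePoisson_nonneg {r : ℝ} (h0 : 0 ≤ r) (h1 : r < 1) (x : AddCircle (1 : ℝ)) :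
    0 ≤ circlePoisson r x := by
  unfold circlePoisson
  have : 0 ≤ 1 - r ^ 2 := by nlinarith
  positivity

theorem circlePoisson_le {r : ℝ} (h0 : 0 ≤ r) (h1 : r < 1) (x : AddCircle (1 : ℝ)) :
    circlePoisson r x ≤ (1 + r) / (1 - r) := by
  unfold circlePoisson
  have h : 1 - r ≤ ‖1 - (r : ℂ) * fourier 1 x‖ := by
    have := norm_sub_norm_le (1 : ℂ) ((r : ℂ) * fourier 1 x)
    rwa [norm_mul, norm_fourier_apply, Complex.norm_real, Real.norm_of_nonneg h0, norm_one,
      mul_one] at this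
  have hp : 0 < 1 - r := by linarith
  rw [div_le_div_iff₀ (pow_pos (hp.trans_le h) 2) hp]
  have := pow_le_pow_left₀ hp.le h 2
  nlinarith

-- The kernel is `1 - r²` times the squared modulus of a geometric series, and `∑ r^m r^(m+a) = r^a
-- / (1 - r²)`. Negative frequencies follow by conjugation, since the kernel is real.
open MeasureTheory AddCircle in
theorem integral_circlePoisson_mul_fourier {r : ℝ} (h0 : 0 ≤ r) (h1 : r < 1) (a : ℤ) :
    ∫ x, (circlePoisson r x : ℂ) * fourier a x ∂haarAddCircle = (r : ℂ) ^ a.natAbs := by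
  have hr : |r| < 1 := by rwa [abs_of_nonneg h0]
  have key (a : ℕ) : ∫ x, (circlePoisson r x : ℂ) * fourier (a : ℤ) x ∂haarAddCircle
      = (r : ℂ) ^ a := by
    have h := integral_normSq_mul_fourier (fun m => r ^ m)
      (by simpa [abs_pow] using summable_geometric_of_abs_lt_one (r := |r|) (by simpa using hr))
      (fun x => (1 - (r : ℂ) * fourier 1 x)⁻¹) (fun x => by
        have := hasSum_geometric_of_norm_lt_one (ξ := (r : ℂ) * fourier 1 x)
          (by rwa [norm_mul_fourier_one])
        refine this.congr_fun fun m => ?_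
        rw [mul_pow, fourier_natCast_eq_pow, Complex.ofReal_pow]) a
    have h2 : ∑' m, ((r ^ m : ℝ) : ℂ) * ((r ^ (m + a) : ℝ) : ℂ)
        = (r : ℂ) ^ a * (1 - (r : ℂ) ^ 2)⁻¹ := by
      rw [← tsum_geometric_of_norm_lt_one, ← tsum_mul_left]
      · refine tsum_congr fun m => ?_
        push_cast
        ring
      · rw [norm_pow, Complex.norm_real, Real.norm_eq_abs]
        exact pow_lt_one₀ (abs_nonneg _) hr two_ne_zero
    rw [h2] at h
    have h3 : (1 - (r : ℂ) ^ 2) ≠ 0 := by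
      have : (1 - r ^ 2 : ℝ) ≠ 0 := by nlinarith
      exact_mod_cast this
    calc _ = ∫ x, (1 - (r : ℂ) ^ 2) * (((‖(1 - (r : ℂ) * fourier 1 x)⁻¹‖ ^ 2 : ℝ) : ℂ)
          * fourier (a : ℤ) x) ∂haarAddCircle := by
            refine integral_congr_ae (Eventually.of_forall fun x => ?_)
            simp only [circlePoisson]
            push_cast
            rw [norm_inv]
            push_cast
            ring
      _ = _ := by rw [integral_const_mul, h]; field_simp
  obtain ⟨n, rfl | rfl⟩ := a.eq_nat_or_neg
  · simpa using key n
  · have := congrArg (starRingEnd ℂ) (key n)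
    rw [← integral_conj] at this
    rw [Int.natAbs_neg, Int.natAbs_natCast]
    simpa only [map_mul, map_pow, Complex.conj_ofReal, ← fourier_neg] using this

-- Dropping the numerator's power leaves the squared modulus of `(1 - rz)^(-(l+1))`. Parseval turns
-- its integral into a sum of squared binomial coefficients, and `choose_sq_le_choose` compares that
-- sum with the series of `(1 - r²)^(-(l+1)²)`. This is the efficient bound when `r` is small
-- compared with `1/l`.
open MeasureTheory AddCircle in
theorem integral_circlePoisson_pow_le {r : ℝ} (h0 : 0 ≤ r) (h1 : r < 1) (l : ℕ) :
    ∫ x, circlePoisson r x ^ (l + 1) ∂haarAddCircle ≤ ((1 - r ^ 2)⁻¹) ^ ((l + 1) ^ 2) := by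
  have hr : |r| < 1 := by rwa [abs_of_nonneg h0]
  have hr2 : 0 < 1 - r ^ 2 := by nlinarith
  have hr3 : ‖r ^ 2‖ < 1 := by rw [Real.norm_of_nonneg (by positivity)]; linarith
  set b : ℕ → ℝ := fun m => ((m + l).choose l : ℝ) * r ^ m with hbdef
  have hb0 (m) : 0 ≤ b m := by simp only [hbdef]; positivity
  have hbs : Summable fun m => |b m| := by
    simp_rw [abs_of_nonneg (hb0 _)]
    exact summable_choose_mul_geometric_of_norm_lt_one l (by simpa using hr)
  have h := integral_normSq_mul_fourier b hbs
      (fun x => 1 / (1 - (r : ℂ) * fourier 1 x) ^ (l + 1)) (fun x => by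
        have := hasSum_choose_mul_geometric_of_norm_lt_one l (r := (r : ℂ) * fourier 1 x)
          (by rwa [norm_mul_fourier_one])
        refine this.congr_fun fun m => ?_
        simp only [hbdef]
        rw [mul_pow, fourier_natCast_eq_pow, Complex.ofReal_mul, Complex.ofReal_pow,
          Complex.ofReal_natCast, mul_assoc]) 0
  have hle : ∫ x : AddCircle (1 : ℝ), ‖1 / (1 - (r : ℂ) * fourier 1 x) ^ (l + 1)‖ ^ 2 ∂haarAddCircle
      ≤ ((1 - r ^ 2)⁻¹) ^ ((l + 1) ^ 2) := by
    have e : ∫ x : AddCircle (1 : ℝ), ‖1 / (1 - (r : ℂ) * fourier 1 x) ^ (l + 1)‖ ^ 2 ∂haarAddCircle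
        = ∑' m, b m ^ 2 := by
      have h' : ((∫ x : AddCircle (1 : ℝ), ‖1 / (1 - (r : ℂ) * fourier 1 x) ^ (l + 1)‖ ^ 2 ∂haarAddCircle : ℝ) : ℂ)
          = ((∑' m, b m ^ 2 : ℝ) : ℂ) := by
        rw [← integral_complex_ofReal, Complex.ofReal_tsum]
        simp only [Nat.cast_zero, fourier_zero, mul_one, add_zero] at h
        rw [h]
        refine tsum_congr fun m => ?_
        push_cast; ring
      exact_mod_cast h'
    rw [e]
    obtain ⟨q, hq⟩ : ∃ q, (l + 1) ^ 2 = q + 1 := ⟨l ^ 2 + 2 * l, by ring⟩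
    have hsq := hasSum_choose_mul_geometric_of_norm_lt_one q hr3
    have hterm (m) : b m ^ 2 ≤ ((m + q).choose q : ℝ) * (r ^ 2) ^ m := by
      have := choose_sq_le_choose l m
      rw [hq, Nat.add_sub_cancel] at this
      simp only [hbdef, mul_pow, ← pow_mul, mul_comm m 2]
      gcongr
      exact_mod_cast this
    calc ∑' m, b m ^ 2 ≤ ∑' m, ((m + q).choose q : ℝ) * (r ^ 2) ^ m :=
          (hsq.summable.of_nonneg_of_le (fun m => sq_nonneg _) hterm).tsum_le_tsum hterm
            hsq.summable
      _ = _ := by rw [hsq.tsum_eq, hq]; simp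
  refine le_trans ?_ hle
  have hcont : Continuous fun x : AddCircle (1 : ℝ) =>
      ‖1 / (1 - (r : ℂ) * fourier 1 x) ^ (l + 1)‖ ^ 2 := by
    refine (Continuous.norm (Continuous.div (by fun_prop) (by fun_prop) fun x => ?_)).pow 2
    exact pow_ne_zero _ (one_sub_mul_fourier_ne_zero h0 h1 x)
  refine integral_mono ?_ ?_ fun x => ?_
  · exact ((continuous_circlePoisson h0 h1).pow _).integrable_of_hasCompactSupport
      (HasCompactSupport.of_compactSpace _)
  · exact hcont.integrable_of_hasCompactSupport (HasCompactSupport.of_compactSpace _)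
  · simp only [circlePoisson, norm_div, norm_one, norm_pow, div_pow, one_pow]
    rw [← pow_mul, ← pow_mul, mul_comm 2]
    gcongr
    exact pow_le_one₀ hr2.le (by nlinarith)

-- The maximum of the kernel; preferable to the quadratic exponent once `r` is large compared with
-- `1/l`.
open MeasureTheory AddCircle in
theorem integral_circlePoisson_pow_le_div_pow {r : ℝ} (h0 : 0 ≤ r) (h1 : r < 1) (l : ℕ) :
    ∫ x, circlePoisson r x ^ l ∂haarAddCircle ≤ ((1 + r) / (1 - r)) ^ l := by
  have : ∫ x, circlePoisson r x ^ l ∂haarAddCircle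
      ≤ ∫ _x : AddCircle (1 : ℝ), ((1 + r) / (1 - r)) ^ l ∂haarAddCircle := by
    refine integral_mono ?_ (integrable_const _) fun x => ?_
    · exact ((continuous_circlePoisson h0 h1).pow _).integrable_of_hasCompactSupport
        (HasCompactSupport.of_compactSpace _)
    · exact pow_le_pow_left₀ (circlePoisson_nonneg h0 h1 x) (circlePoisson_le h0 h1 x) l
  simpa using this

/-! ### The GCD form as an integral over a torus indexed by primes. -/

theorem natCast_eq_prod_pow_factorization {m : ℕ} (hm : m ≠ 0) {S : Finset ℕ}
    (hS : m.primeFactors ⊆ S) : (m : ℝ) = ∏ p ∈ S, (p : ℝ) ^ m.factorization p := by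
  conv_lhs => rw [← Nat.prod_factorization_pow_eq_self hm]
  rw [Finsupp.prod_of_support_subset _ (s := S) (by simpa using hS) _ (by simp)]
  push_cast
  rfl

/-- Prime by prime, `a + b - 2 min(a, b) = |a - b|`. This is the shape of a Fourier coefficient of a
Poisson kernel. -/
theorem rpow_gcd_div_eq_prod (α : ℝ) {m n : ℕ} (hm : m ≠ 0) (hn : n ≠ 0) {S : Finset ℕ}
    (hSm : m.primeFactors ⊆ S) (hSn : n.primeFactors ⊆ S) (hSp : ∀ p ∈ S, p.Prime) :
    (Nat.gcd m n : ℝ) ^ (2 * α) / ((m : ℝ) * (n : ℝ)) ^ α =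
      ∏ p ∈ S, ((p : ℝ) ^ (-α)) ^ ((m.factorization p : ℤ) - n.factorization p).natAbs := by
  have hg : Nat.gcd m n ≠ 0 := Nat.gcd_ne_zero_left hm
  have hSg : (Nat.gcd m n).primeFactors ⊆ S :=
    (Nat.primeFactors_mono (Nat.gcd_dvd_left m n) hm).trans hSm
  rw [natCast_eq_prod_pow_factorization hg hSg, natCast_eq_prod_pow_factorization hm hSm,
    natCast_eq_prod_pow_factorization hn hSn, ← Finset.prod_mul_distrib,
    ← Real.finsetProd_rpow _ _ (fun p _ => by positivity),
    ← Real.finsetProd_rpow _ _ (fun p _ => by positivity), ← Finset.prod_div_distrib]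
  refine Finset.prod_congr rfl fun p hp => ?_
  have hp0 : (0 : ℝ) < p := by exact_mod_cast (hSp p hp).pos
  rw [Nat.factorization_gcd hm hn, Finsupp.inf_apply, ← pow_add, ← Real.rpow_natCast,
    ← Real.rpow_natCast, ← Real.rpow_natCast, ← Real.rpow_mul hp0.le, ← Real.rpow_mul hp0.le,
    ← Real.rpow_mul hp0.le, ← Real.rpow_sub hp0]
  congr 1
  generalize m.factorization p = a
  generalize n.factorization p = b
  have h : (((a : ℤ) - b).natAbs : ℝ) = (a + b : ℕ) - 2 * (a ⊓ b : ℕ) := by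
    rcases le_total a b with hab | hab
    · obtain ⟨d, rfl⟩ := Nat.exists_eq_add_of_le hab
      rw [inf_eq_left.mpr hab, show ((a : ℤ) - (a + d : ℕ)).natAbs = d by omega]
      push_cast; ring
    · obtain ⟨d, rfl⟩ := Nat.exists_eq_add_of_le hab
      rw [inf_eq_right.mpr hab, show (((b + d : ℕ) : ℤ) - b).natAbs = d by omega]
      push_cast; ring
  rw [h]
  ring

section torus

open MeasureTheory AddCircle

/-- The Haar probability measure of the torus with one circle for each element of `S`. -/
noncomputable def torusHaar (S : Finset ℕ) : Measure (S → AddCircle (1 : ℝ)) :=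
  Measure.pi fun _ => haarAddCircle

instance (S : Finset ℕ) : IsProbabilityMeasure (torusHaar S) := by
  unfold torusHaar; infer_instance

/-- The character of the torus with frequencies `a`. -/
noncomputable def torusChar {S : Finset ℕ} (a : S → ℤ) (x : S → AddCircle (1 : ℝ)) : ℂ :=
  ∏ p, fourier (a p) (x p)

/-- The product of the Poisson kernels of radius `p ^ (-α)` over the coordinates `p`. -/
noncomputable def torusPoisson {S : Finset ℕ} (α : ℝ) (x : S → AddCircle (1 : ℝ)) : ℝ :=
  ∏ p : S, circlePoisson ((p : ℝ) ^ (-α)) (x p)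

/-- The Bohr lift of the Dirichlet polynomial with frequencies `n` and coefficients `c`. -/
noncomputable def dirichletPoly {k : ℕ} (S : Finset ℕ) (n : Fin k → ℕ)
    (c : EuclideanSpace ℂ (Fin k)) (x : S → AddCircle (1 : ℝ)) : ℂ :=
  ∑ i, c i * torusChar (fun p : S => ((n i).factorization p : ℤ)) x

variable {S : Finset ℕ}

theorem norm_torusChar (a : S → ℤ) (x : S → AddCircle (1 : ℝ)) : ‖torusChar a x‖ = 1 := by
  simp [torusChar, norm_fourier_apply, -fourier_apply]

theorem torusChar_mul_conj (a b : S → ℤ) (x : S → AddCircle (1 : ℝ)) :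
    torusChar a x * (starRingEnd ℂ) (torusChar b x) = torusChar (a - b) x := by
  simp only [torusChar, map_prod, ← fourier_neg, ← Finset.prod_mul_distrib, ← fourier_add,
    Pi.sub_apply, sub_eq_add_neg]

theorem continuous_torusChar (a : S → ℤ) : Continuous (torusChar a) := by
  unfold torusChar; fun_prop

theorem rpow_neg_mem_Ico {α : ℝ} (hα : 0 < α) {p : ℕ} (hp : p.Prime) :
    0 ≤ (p : ℝ) ^ (-α) ∧ (p : ℝ) ^ (-α) < 1 :=
  ⟨by positivity, Real.rpow_lt_one_of_one_lt_of_neg (by exact_mod_cast hp.one_lt) (by linarith)⟩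

theorem continuous_torusPoisson {α : ℝ} (hα : 0 < α) (hS : ∀ p ∈ S, p.Prime) :
    Continuous (torusPoisson (S := S) α) := by
  unfold torusPoisson
  refine continuous_finsetProd _ fun p _ => ?_
  obtain ⟨h0, h1⟩ := rpow_neg_mem_Ico hα (hS p p.2)
  exact (continuous_circlePoisson h0 h1).comp (continuous_apply p)

theorem torusPoisson_nonneg {α : ℝ} (hα : 0 < α) (hS : ∀ p ∈ S, p.Prime)
    (x : S → AddCircle (1 : ℝ)) : 0 ≤ torusPoisson α x :=
  Finset.prod_nonneg fun p _ => circlePoisson_nonneg (rpow_neg_mem_Ico hα (hS p p.2)).1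
    (rpow_neg_mem_Ico hα (hS p p.2)).2 _

theorem integral_torusChar (a : S → ℤ) :
    ∫ x, torusChar a x ∂torusHaar S = if a = 0 then 1 else 0 := by
  have h := integral_fintype_prod_eq_prod (𝕜 := ℂ) (μ := fun _ : S => haarAddCircle (T := (1 : ℝ)))
    (fun (p : S) (x : AddCircle (1 : ℝ)) => (fourier (a p) x : ℂ))
  unfold torusChar torusHaar
  rw [h]
  simp_rw [integral_fourier_haar]
  split_ifs with h0
  · simp [h0]
  · obtain ⟨p, hp⟩ := Function.ne_iff.mp h0
    exact Finset.prod_eq_zero (Finset.mem_univ p) (by simpa using hp)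

theorem integral_torusPoisson_mul_torusChar {α : ℝ} (hα : 0 < α) (hS : ∀ p ∈ S, p.Prime)
    (a : S → ℤ) :
    ∫ x, (torusPoisson α x : ℂ) * torusChar a x ∂torusHaar S
      = ∏ p : S, (((p : ℝ) ^ (-α) : ℝ) : ℂ) ^ (a p).natAbs := by
  have h := integral_fintype_prod_eq_prod (𝕜 := ℂ) (μ := fun _ : S => haarAddCircle (T := (1 : ℝ)))
    (fun (p : S) (x : AddCircle (1 : ℝ)) =>
      (circlePoisson ((p : ℝ) ^ (-α)) x : ℂ) * (fourier (a p) x : ℂ))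
  unfold torusChar torusHaar torusPoisson
  simp_rw [Complex.ofReal_prod, ← Finset.prod_mul_distrib]
  rw [h]
  refine Finset.prod_congr rfl fun p _ => ?_
  obtain ⟨h0, h1⟩ := rpow_neg_mem_Ico hα (hS p p.2)
  exact integral_circlePoisson_mul_fourier h0 h1 _

theorem integral_torusPoisson_pow (α : ℝ) (l : ℕ) :
    ∫ x, torusPoisson α x ^ l ∂torusHaar S
      = ∏ p : S, ∫ x, circlePoisson ((p : ℝ) ^ (-α)) x ^ l ∂haarAddCircle := by
  unfold torusHaar torusPoisson
  simp_rw [← Finset.prod_pow]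
  exact integral_fintype_prod_eq_prod (𝕜 := ℝ) (μ := fun _ : S => haarAddCircle (T := (1 : ℝ)))
    (fun (p : S) (x : AddCircle (1 : ℝ)) => circlePoisson ((p : ℝ) ^ (-α)) x ^ l)

variable {k : ℕ}

theorem continuous_dirichletPoly (n : Fin k → ℕ) (c : EuclideanSpace ℂ (Fin k)) :
    Continuous (dirichletPoly S n c) := by
  unfold dirichletPoly
  exact continuous_finsetSum _ fun i _ => continuous_const.mul (continuous_torusChar _)

theorem normSq_dirichletPoly (n : Fin k → ℕ) (c : EuclideanSpace ℂ (Fin k))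
    (x : S → AddCircle (1 : ℝ)) :
    ((‖dirichletPoly S n c x‖ ^ 2 : ℝ) : ℂ) = ∑ i, ∑ j, c i * (starRingEnd ℂ) (c j) *
      torusChar (fun p : S => ((n i).factorization p : ℤ) - (n j).factorization p) x := by
  rw [← Complex.normSq_eq_norm_sq, ← Complex.mul_conj]
  unfold dirichletPoly
  rw [map_sum, Finset.sum_mul_sum]
  refine Finset.sum_congr rfl fun i _ => Finset.sum_congr rfl fun j _ => ?_
  have := torusChar_mul_conj (fun p : S => ((n i).factorization p : ℤ))
    (fun p : S => ((n j).factorization p : ℤ)) x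
  rw [map_mul, mul_mul_mul_comm, this]
  rfl

/-- Cauchy–Schwarz; this is how `k` enters the moment bound. -/
theorem normSq_dirichletPoly_le (n : Fin k → ℕ) (c : EuclideanSpace ℂ (Fin k))
    (x : S → AddCircle (1 : ℝ)) : ‖dirichletPoly S n c x‖ ^ 2 ≤ k * ‖c‖ ^ 2 := by
  have h : ‖dirichletPoly S n c x‖ ≤ ∑ i, ‖c i‖ := by
    refine (norm_sum_le _ _).trans_eq (Finset.sum_congr rfl fun i _ => ?_)
    rw [norm_mul, norm_torusChar, mul_one]
  calc _ ≤ (∑ i, ‖c i‖) ^ 2 := pow_le_pow_left₀ (norm_nonneg _) h 2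
    _ ≤ k * ∑ i, ‖c i‖ ^ 2 := by
        simpa using sq_sum_le_card_mul_sum_sq (s := Finset.univ) (f := fun i => ‖c i‖)
    _ = _ := by rw [EuclideanSpace.norm_sq_eq]

theorem Continuous.integrable_torusHaar {E : Type*} [NormedAddCommGroup E]
    {f : (S → AddCircle (1 : ℝ)) → E} (hf : Continuous f) : Integrable f (torusHaar S) :=
  hf.integrable_of_hasCompactSupport (HasCompactSupport.of_compactSpace _)

/-- Since `S` contains every prime involved, unique factorisation gives distinct integers distinct
characters, and these are orthonormal. -/
theorem integral_normSq_dirichletPoly {n : Fin k → ℕ} (hn : Function.Injective n)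
    (hn0 : ∀ i, n i ≠ 0) (hS : ∀ i, (n i).primeFactors ⊆ S) (c : EuclideanSpace ℂ (Fin k)) :
    ∫ x, ‖dirichletPoly S n c x‖ ^ 2 ∂torusHaar S = ‖c‖ ^ 2 := by
  have h : ((∫ x, ‖dirichletPoly S n c x‖ ^ 2 ∂torusHaar S : ℝ) : ℂ) = ((‖c‖ ^ 2 : ℝ) : ℂ) := by
    rw [← integral_complex_ofReal]
    simp_rw [normSq_dirichletPoly]
    have hcont (i j : Fin k) : Continuous fun x : S → AddCircle (1 : ℝ) =>
        c i * (starRingEnd ℂ) (c j) *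
          torusChar (fun p : S => ((n i).factorization p : ℤ) - (n j).factorization p) x :=
      continuous_const.mul (continuous_torusChar _)
    rw [integral_finsetSum _ fun i _ => Continuous.integrable_torusHaar
      (continuous_finsetSum _ fun j _ => hcont i j)]
    simp_rw [integral_finsetSum _ fun j _ => Continuous.integrable_torusHaar (hcont _ j),
      integral_const_mul, integral_torusChar]
    rw [EuclideanSpace.norm_sq_eq, Complex.ofReal_sum]
    refine Finset.sum_congr rfl fun i _ => ?_
    rw [Finset.sum_eq_single i]
    · have : (fun p : S => ((n i).factorization p : ℤ) - (n i).factorization p) = 0 := by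
        ext p; simp
      rw [if_pos this, mul_one, Complex.mul_conj, Complex.normSq_eq_norm_sq]
    · intro j _ hj
      rw [if_neg, mul_zero]
      intro h0
      refine hj (hn (Nat.eq_of_factorization_eq (hn0 j) (hn0 i) fun p => ?_))
      by_cases hp : p ∈ S
      · have := congrFun h0 ⟨p, hp⟩
        simp only [Pi.zero_apply] at this
        omega
      · have h1 (i : Fin k) : (n i).factorization p = 0 :=
          Finsupp.notMem_support_iff.mp fun h => hp (hS i (by simpa using h))
        rw [h1, h1]
    · simp
  exact_mod_cast h

theorem gcdForm_eq_integral {α : ℝ} (hα : 0 < α) {n : Fin k → ℕ} (hn0 : ∀ i, n i ≠ 0)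
    (hS : ∀ i, (n i).primeFactors ⊆ S) (hSp : ∀ p ∈ S, p.Prime)
    (c : EuclideanSpace ℂ (Fin k)) :
    gcdForm α n c
      = ((∫ x, torusPoisson α x * ‖dirichletPoly S n c x‖ ^ 2 ∂torusHaar S : ℝ) : ℂ) := by
  have hP : Continuous fun x : S → AddCircle (1 : ℝ) => (torusPoisson α x : ℂ) :=
    Complex.continuous_ofReal.comp (continuous_torusPoisson hα hSp)
  have hc (i j : Fin k) : Continuous fun x : S → AddCircle (1 : ℝ) =>
      c i * (starRingEnd ℂ) (c j) * ((torusPoisson α x : ℂ) *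
        torusChar (fun p : S => ((n i).factorization p : ℤ) - (n j).factorization p) x) :=
    continuous_const.mul (hP.mul (continuous_torusChar _))
  rw [← integral_complex_ofReal]
  simp_rw [Complex.ofReal_mul, normSq_dirichletPoly, Finset.mul_sum, mul_left_comm (torusPoisson α _ : ℂ)]
  rw [integral_finsetSum _ fun i _ => Continuous.integrable_torusHaar
      (continuous_finsetSum _ fun j _ => hc i j)]
  simp_rw [integral_finsetSum _ fun j _ => Continuous.integrable_torusHaar (hc _ j),
    integral_const_mul, integral_torusPoisson_mul_torusChar hα hSp]
  unfold gcdForm gcdMatrix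
  refine Finset.sum_congr rfl fun i _ => Finset.sum_congr rfl fun j _ => ?_
  rw [rpow_gcd_div_eq_prod α (hn0 i) (hn0 j) (hS i) (hS j) hSp, ← Finset.prod_coe_sort]
  push_cast
  ring

/-- Moments of the Poisson kernel bound the spectral norm. -/
theorem gcdSpectralNorm_le_of_moment {α : ℝ} (hα : 0 < α) {n : Fin k → ℕ}
    (hn : Function.Injective n) (hn0 : ∀ i, n i ≠ 0) (hS : ∀ i, (n i).primeFactors ⊆ S)
    (hSp : ∀ p ∈ S, p.Prime) {l : ℕ} (hl : l ≠ 0) {V : ℝ} (hV : 0 < V) (B : ℕ → ℝ)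
    (hB : ∀ p ∈ S, ∫ x, circlePoisson ((p : ℝ) ^ (-α)) x ^ l ∂haarAddCircle ≤ B p)
    (h : k * ∏ p ∈ S, B p ≤ V ^ l) : gcdSpectralNorm α n ≤ V := by
  refine Real.sSup_le ?_ hV.le
  rintro _ ⟨c, hc, rfl⟩
  have hPc := continuous_torusPoisson hα hSp
  have hDc : Continuous fun x => ‖dirichletPoly S n c x‖ ^ 2 :=
    (continuous_dirichletPoly n c).norm.pow 2
  have hP0 := torusPoisson_nonneg hα hSp
  have hl0 : (0 : ℝ) < l := by positivity
  have hmom : ∫ x, torusPoisson α x ^ l ∂torusHaar S ≤ ∏ p ∈ S, B p := by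
    rw [integral_torusPoisson_pow, ← Finset.prod_coe_sort S B]
    refine Finset.prod_le_prod (fun (p : S) _ => integral_nonneg fun x => pow_nonneg ?_ l)
      fun p _ => hB p p.2
    exact circlePoisson_nonneg (rpow_neg_mem_Ico hα (hSp p p.2)).1
      (rpow_neg_mem_Ico hα (hSp p p.2)).2 _
  -- Convexity of `w^l`: the graph lies above its tangent at `w = V`. Integrated against `|D|²`,
  -- this plays the part of Hölder's inequality.
  have hbern (w : ℝ) (hw : 0 ≤ w) : w ≤ V * (1 - 1 / l) + V / l * (w ^ l / V ^ l) := by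
    have h1 := one_add_mul_le_pow (a := w / V - 1)
      (by have : 0 ≤ w / V := by positivity
          linarith) l
    rw [add_sub_cancel, div_pow] at h1
    have h2 := mul_le_mul_of_nonneg_left h1 (show 0 ≤ V / l by positivity)
    calc w = V * (1 - 1 / l) + V / l * (1 + l * (w / V - 1)) := by field_simp; ring
      _ ≤ _ := by linarith
  rw [gcdForm_eq_integral hα hn0 hS hSp, Complex.norm_real, Real.norm_of_nonneg
    (integral_nonneg fun x => mul_nonneg (hP0 x) (sq_nonneg _))]
  have hcard (x) : ‖dirichletPoly S n c x‖ ^ 2 ≤ k := by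
    simpa [hc] using normSq_dirichletPoly_le (S := S) n c x
  calc ∫ x, torusPoisson α x * ‖dirichletPoly S n c x‖ ^ 2 ∂torusHaar S
      ≤ ∫ x, (V * (1 - 1 / l) * ‖dirichletPoly S n c x‖ ^ 2
          + V / l / V ^ l * k * torusPoisson α x ^ l) ∂torusHaar S := by
        refine integral_mono (hPc.mul hDc).integrable_torusHaar
          ((continuous_const.mul hDc).add
            (continuous_const.mul (hPc.pow l))).integrable_torusHaar fun x => ?_
        have h1 := mul_le_mul_of_nonneg_right (hbern _ (hP0 x))
          (sq_nonneg ‖dirichletPoly S n c x‖)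
        have h2 := mul_le_mul_of_nonneg_left (hcard x)
          (show 0 ≤ V / l / V ^ l * torusPoisson α x ^ l from
            mul_nonneg (by positivity) (pow_nonneg (hP0 x) l))
        calc _ ≤ _ := h1
          _ = V * (1 - 1 / l) * ‖dirichletPoly S n c x‖ ^ 2 + V / l / V ^ l * torusPoisson α x ^ l
              * ‖dirichletPoly S n c x‖ ^ 2 := by ring
          _ ≤ _ := add_le_add_right h2 _
          _ = _ := by ring
    _ = V * (1 - 1 / l) + V / l / V ^ l * (k * ∫ x, torusPoisson α x ^ l ∂torusHaar S) := by
        have i1 : Integrable (fun x => V * (1 - 1 / l) * ‖dirichletPoly S n c x‖ ^ 2)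
          (torusHaar S) := (continuous_const.mul hDc).integrable_torusHaar
        have i2 : Integrable (fun x => V / l / V ^ l * k * torusPoisson α x ^ l)
          (torusHaar S) := (continuous_const.mul (hPc.pow l)).integrable_torusHaar
        rw [integral_add i1 i2, integral_const_mul,
          integral_const_mul, integral_normSq_dirichletPoly hn hn0 hS, hc]
        ring
    _ ≤ V * (1 - 1 / l) + V / l / V ^ l * V ^ l := by
        gcongr
        exact (mul_le_mul_of_nonneg_left hmom (by positivity)).trans h
    _ = V := by field_simp; ring

end torus

/-! ### Abel summation with signed weights, and Chebyshev-type sums over primes. -/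

/-- A weighted sum of `h` is controlled by the weights of the superlevel sets of `h`. -/
theorem Finset.sum_mul_le_of_superlevel {ι : Type*} (I : Finset ι) (w : ι → ℝ) {C : ℝ} :
    ∀ (h : ι → ℝ) (G : ℝ), 0 ≤ G → 0 ≤ C → (∀ i ∈ I, 0 ≤ h i ∧ h i ≤ G) →
      (∀ t, 0 ≤ t → ∑ i ∈ I with t < h i, w i ≤ C) → ∑ i ∈ I, w i * h i ≤ C * G := by
  induction I using Finset.strongInduction with
  | H I ih =>
    intro h G hG hC hI hl
    rcases I.eq_empty_or_nonempty with rfl | hne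
    · simpa using mul_nonneg hC hG
    -- Layer-cake argument: the lowest layer, of height `h i₀`, is peeled off, and induction applies
    -- to the strictly higher indices.
    obtain ⟨i₀, hi₀, hmin⟩ := I.exists_min_image h hne
    have hm0 := (hI i₀ hi₀).1
    have hsub : I.filter (fun i => h i₀ < h i) ⊂ I :=
      Finset.filter_ssubset.mpr ⟨i₀, hi₀, lt_irrefl _⟩
    have h1 := ih _ hsub (fun i => h i - h i₀) (G - h i₀) (by linarith [(hI i₀ hi₀).2]) hC
      (fun i hi => by
        rw [Finset.mem_filter] at hi
        constructor <;> linarith [(hI i hi.1).2])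
      (fun t ht => by
        refine le_trans (le_of_eq ?_) (hl (t + h i₀) (by linarith))
        rw [Finset.filter_filter]
        refine Finset.sum_congr (Finset.filter_congr fun i _ => ?_) fun _ _ => rfl
        constructor
        · rintro ⟨-, h2⟩; linarith
        · intro h2; constructor <;> linarith)
    have h2 : ∑ i ∈ I with h i₀ < h i, w i * (h i - h i₀) = ∑ i ∈ I, w i * (h i - h i₀) := by
      refine Finset.sum_filter_of_ne fun i hi hne => ?_
      refine lt_of_le_of_ne (hmin i hi) fun he => hne ?_
      rw [← he, sub_self, mul_zero]
    have h3 : h i₀ * ∑ i ∈ I, w i ≤ h i₀ * C := by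
      rcases hm0.eq_or_lt with h0 | h0
      · rw [← h0]; simp
      · refine mul_le_mul_of_nonneg_left ?_ hm0
        have := hl 0 le_rfl
        rwa [Finset.filter_true_of_mem fun i hi => h0.trans_le (hmin i hi)] at this
    rw [h2] at h1
    have h4 : ∑ i ∈ I, w i * h i = ∑ i ∈ I, w i * (h i - h i₀) + h i₀ * ∑ i ∈ I, w i := by
      rw [Finset.mul_sum, ← Finset.sum_add_distrib]
      exact Finset.sum_congr rfl fun i _ => by ring
    rw [h4]
    linarith

/-- Abel's inequality for a weighted sum of an antitone function. -/
theorem Finset.sum_mul_antitoneOn_le {ι : Type*} (I : Finset ι) (w u : ι → ℝ) {s : Set ℝ}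
    {g : ℝ → ℝ} (hu : ∀ i ∈ I, u i ∈ s) (hg : AntitoneOn g s) {C G : ℝ} (hC : 0 ≤ C)
    (hG : 0 ≤ G) (h0 : ∀ x ∈ s, 0 ≤ g x ∧ g x ≤ G)
    (hw : ∀ v, ∑ i ∈ I with u i ≤ v, w i ≤ C) : ∑ i ∈ I, w i * g (u i) ≤ C * G := by
  refine I.sum_mul_le_of_superlevel w (fun i => g (u i)) G hG hC (fun i hi => h0 _ (hu i hi))
    fun t _ => ?_
  rcases (I.filter fun i => t < g (u i)).eq_empty_or_nonempty with he | hne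
  · rw [he]; simpa using hC
  · obtain ⟨j, hj, hmax⟩ := Finset.exists_max_image _ u hne
    rw [Finset.mem_filter] at hj
    refine le_trans (le_of_eq ?_) (hw (u j))
    refine Finset.sum_congr (Finset.filter_congr fun i hi => ⟨fun h => ?_, fun h => ?_⟩)
      fun _ _ => rfl
    · exact hmax i (Finset.mem_filter.mpr ⟨hi, h⟩)
    · exact hj.2.trans_le (hg (hu i hi) (hu j hj.1) h)

/-- Abel's inequality for the weights `1_{n prime} log n - log 4`, whose partial sums are
nonpositive by Chebyshev's bound `θ(x) ≤ x log 4`. -/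
theorem sum_prime_log_mul_le {g : ℝ → ℝ} (hg : AntitoneOn g (Set.Ici 1))
    (h0 : ∀ x, 1 ≤ x → 0 ≤ g x) (N : ℕ) :
    ∑ p ∈ Finset.Icc 1 N with p.Prime, Real.log p * g p
      ≤ Real.log 4 * ∑ n ∈ Finset.Icc 1 N, g n := by
  have h := (Finset.Icc 1 N).sum_mul_antitoneOn_le
    (fun n => (if n.Prime then Real.log n else 0) - Real.log 4) (fun n => (n : ℝ))
    (s := Set.Ici 1) (g := g) (fun n hn => by
      simpa using (Finset.mem_Icc.mp hn).1) hg (C := 0) (G := g 1) le_rfl (h0 1 le_rfl)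
    (fun x hx => ⟨h0 x hx, hg (Set.mem_Ici.mpr le_rfl) hx hx⟩) (fun v => by
      rw [Finset.sum_sub_distrib, sub_nonpos]
      rcases lt_or_ge v 0 with hv | hv
      · rw [Finset.filter_false_of_mem]
        · simp
        · intro n _
          have : (0 : ℝ) ≤ n := n.cast_nonneg
          linarith
      have hf : (Finset.Icc 1 N).filter (fun n : ℕ => (n : ℝ) ≤ v) = Finset.Icc 1 (min N ⌊v⌋₊) := by
        ext n
        simp [Nat.le_floor_iff hv, and_assoc]
      rw [hf, ← Finset.sum_filter, Finset.sum_const, Nat.card_Icc, Nat.add_sub_cancel,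
        nsmul_eq_mul]
      have := Chebyshev.theta_le_log4_mul_x (x := (min N ⌊v⌋₊ : ℕ)) (Nat.cast_nonneg _)
      rw [Chebyshev.theta, Nat.floor_natCast, mul_comm] at this
      exact this)
  rw [zero_mul] at h
  simp only [sub_mul, ite_mul, zero_mul, Finset.sum_sub_distrib, ← Finset.mul_sum,
    ← Finset.sum_filter] at h
  linarith

theorem sum_Ioc_rpow_neg_le {s : ℝ} (hs : 1 < s) {y N : ℕ} (hy : 1 ≤ y) :
    ∑ n ∈ Finset.Ioc y N, (n : ℝ) ^ (-s) ≤ (y : ℝ) ^ (1 - s) / (s - 1) := by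
  have hs1 : 0 < s - 1 := by linarith
  rcases le_total N y with h | h
  · rw [Finset.Ioc_eq_empty_of_le h, Finset.sum_empty]
    positivity
  have key : ∑ n ∈ Finset.Ioc y N, (n : ℝ) ^ (-s)
      ≤ ((y : ℝ) ^ (1 - s) - (N : ℝ) ^ (1 - s)) / (s - 1) := by
    induction N, h using Nat.le_induction with
    | base => simp
    | succ N hN ih =>
      rw [Finset.sum_Ioc_succ_top (by omega)]
      have hN0 : (0 : ℝ) < N := by exact_mod_cast (by omega : 0 < N)
      have hstep : ((N + 1 : ℕ) : ℝ) ^ (-s)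
          ≤ ((N : ℝ) ^ (1 - s) - ((N + 1 : ℕ) : ℝ) ^ (1 - s)) / (s - 1) := by
        push_cast
        have hM : (0 : ℝ) < N + 1 := by linarith
        have e1 : (N : ℝ) = (N + 1) * (N / (N + 1)) := by field_simp
        have e2 : ((N : ℝ) + 1) ^ (-s) = (N + 1) ^ (1 - s) * (1 / (N + 1)) := by
          rw [show -s = (1 - s) - 1 by ring, Real.rpow_sub_one hM.ne']
          ring
        have e3 : (1 : ℝ) + (s - 1) * (1 / (N + 1)) ≤ (N / (N + 1)) ^ (1 - s) := by
          rw [Real.rpow_def_of_pos (by positivity)]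
          have h1 := Real.add_one_le_exp (Real.log ((N : ℝ) / (N + 1)) * (1 - s))
          have h2 := Real.log_le_sub_one_of_pos (show 0 < (N : ℝ) / (N + 1) by positivity)
          have h3 : (N : ℝ) / (N + 1) - 1 = -(1 / (N + 1)) := by field_simp; ring
          rw [h3] at h2
          have h4 := mul_le_mul_of_nonneg_left h2 hs1.le
          linarith
        have e4 : (N : ℝ) ^ (1 - s) = (N + 1) ^ (1 - s) * (N / (N + 1)) ^ (1 - s) := by
          rw [← Real.mul_rpow hM.le (by positivity), ← e1]
        rw [le_div_iff₀ hs1, e2, e4]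
        have h5 := mul_le_mul_of_nonneg_left e3 (Real.rpow_pos_of_pos hM (1 - s)).le
        linarith
      calc _ ≤ _ := add_le_add ih hstep
        _ = _ := by ring
  refine key.trans ?_
  gcongr
  have : 0 ≤ (N : ℝ) ^ (1 - s) := by positivity
  linarith

theorem sum_Icc_rpow_neg_le {s : ℝ} (hs0 : 0 < s) (hs : s < 1) (N : ℕ) :
    ∑ n ∈ Finset.Icc 1 N, (n : ℝ) ^ (-s) ≤ (N : ℝ) ^ (1 - s) / (1 - s) := by
  have hs1 : 0 < 1 - s := by linarith
  induction N with
  | zero => simp [Real.zero_rpow hs1.ne']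
  | succ N ih =>
    rw [Finset.sum_Icc_succ_top (by omega)]
    have hstep : ((N + 1 : ℕ) : ℝ) ^ (-s)
        ≤ (((N + 1 : ℕ) : ℝ) ^ (1 - s) - (N : ℝ) ^ (1 - s)) / (1 - s) := by
      push_cast
      have hM : (0 : ℝ) < N + 1 := by positivity
      have e1 : (N : ℝ) = (N + 1) * (N / (N + 1)) := by field_simp
      have e2 : ((N : ℝ) + 1) ^ (-s) = (N + 1) ^ (1 - s) * (1 / (N + 1)) := by
        rw [show -s = (1 - s) - 1 by ring, Real.rpow_sub_one hM.ne']
        ring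
      have e3 : ((N : ℝ) / (N + 1)) ^ (1 - s) ≤ 1 - (1 - s) * (1 / (N + 1)) := by
        have h3 : (N : ℝ) / (N + 1) = 1 + -(1 / (N + 1)) := by field_simp; ring
        have hN1 : 1 / ((N : ℝ) + 1) ≤ 1 := by
          rw [div_le_one hM]
          have : (0 : ℝ) ≤ N := N.cast_nonneg
          linarith
        have := rpow_one_add_le_one_add_mul_self (s := -(1 / ((N : ℝ) + 1))) (by linarith)
          hs1.le (by linarith)
        rw [h3]
        linarith
      have e4 : (N : ℝ) ^ (1 - s) = (N + 1) ^ (1 - s) * (N / (N + 1)) ^ (1 - s) := by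
        rw [← Real.mul_rpow hM.le (by positivity), ← e1]
      rw [le_div_iff₀ hs1, e2, e4]
      have h5 := mul_le_mul_of_nonneg_left e3 (Real.rpow_pos_of_pos hM (1 - s)).le
      linarith
    calc _ ≤ _ := add_le_add ih hstep
      _ = _ := by ring

theorem sum_prime_Ioc_log_mul_rpow_neg_le {s : ℝ} (hs : 1 < s) {y N : ℕ} (hy : 1 ≤ y) :
    ∑ p ∈ Finset.Ioc y N with p.Prime, Real.log p * (p : ℝ) ^ (-s)
      ≤ Real.log 4 * (s / (s - 1)) * (y : ℝ) ^ (1 - s) := by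
  have hs1 : 0 < s - 1 := by linarith
  have hy0 : (0 : ℝ) < y := by exact_mod_cast hy
  have hlog4 : 0 ≤ Real.log 4 := Real.log_nonneg (by norm_num)
  rcases le_total N y with h | h
  · rw [Finset.Ioc_eq_empty_of_le h]
    simp only [Finset.filter_empty, Finset.sum_empty]
    positivity
  -- Flattening the function below `y` keeps it antitone from `1` on. The flat part then costs only
  -- `y · y^(-s)`, and no lower bound for `θ(y)` is needed.
  set g : ℝ → ℝ := fun x => (max x y) ^ (-s) with hg
  have hmax (x : ℝ) : 0 < max x y := lt_max_of_lt_right hy0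
  have h1 := sum_prime_log_mul_le (g := g) (fun a _ b _ hab =>
    Real.rpow_le_rpow_of_nonpos (hmax a) (max_le_max_right _ hab) (by linarith))
    (fun x _ => (Real.rpow_pos_of_pos (hmax x) _).le) N
  have hgy : ∀ n ∈ Finset.Ioc y N, g n = (n : ℝ) ^ (-s) := fun n hn => by
    have : (y : ℝ) ≤ n := by exact_mod_cast (Finset.mem_Ioc.mp hn).1.le
    simp [hg, max_eq_left this]
  have h2 : ∑ n ∈ Finset.Icc 1 N, g n ≤ s / (s - 1) * (y : ℝ) ^ (1 - s) := by
    rw [show Finset.Icc 1 N = Finset.Ioc 0 N from rfl,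
      ← Finset.sum_Ioc_consecutive _ (Nat.zero_le y) h, Finset.sum_congr rfl hgy]
    have h3 : ∑ n ∈ Finset.Ioc 0 y, g n = (y : ℝ) ^ (1 - s) := by
      rw [Finset.sum_congr rfl (g := fun _ => (y : ℝ) ^ (-s))]
      · rw [Finset.sum_const, Nat.card_Ioc, Nat.sub_zero, nsmul_eq_mul,
          show 1 - s = 1 + -s by ring, Real.rpow_add hy0, Real.rpow_one]
      · intro n hn
        have : (n : ℝ) ≤ y := by exact_mod_cast (Finset.mem_Ioc.mp hn).2
        simp [hg, max_eq_right this]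
    rw [h3]
    calc _ ≤ (y : ℝ) ^ (1 - s) + (y : ℝ) ^ (1 - s) / (s - 1) := by
          gcongr
          exact sum_Ioc_rpow_neg_le hs hy
      _ = _ := by field_simp; ring
  calc _ = ∑ p ∈ Finset.Ioc y N with p.Prime, Real.log p * g p :=
        Finset.sum_congr rfl fun p hp => by rw [hgy p (Finset.mem_filter.mp hp).1]
    _ ≤ ∑ p ∈ Finset.Icc 1 N with p.Prime, Real.log p * g p := by
        refine Finset.sum_le_sum_of_subset_of_nonneg
          (Finset.filter_subset_filter _ fun n hn => ?_) fun p _ _ => ?_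
        · rw [Finset.mem_Ioc] at hn
          exact Finset.mem_Icc.mpr ⟨by omega, hn.2⟩
        · exact mul_nonneg (Real.log_natCast_nonneg p) (Real.rpow_pos_of_pos (hmax _) _).le
    _ ≤ Real.log 4 * (s / (s - 1) * (y : ℝ) ^ (1 - s)) :=
        h1.trans (mul_le_mul_of_nonneg_left h2 hlog4)
    _ = _ := by ring

theorem sum_prime_Icc_log_mul_rpow_neg_le {s : ℝ} (hs0 : 0 < s) (hs : s < 1) (N : ℕ) :
    ∑ p ∈ Finset.Icc 1 N with p.Prime, Real.log p * (p : ℝ) ^ (-s)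
      ≤ Real.log 4 / (1 - s) * (N : ℝ) ^ (1 - s) := by
  have h1 := sum_prime_log_mul_le (g := fun x => x ^ (-s)) (fun a ha b _ hab =>
    Real.rpow_le_rpow_of_nonpos (lt_of_lt_of_le one_pos ha) hab (by linarith))
    (fun x hx => (Real.rpow_pos_of_pos (by linarith) _).le) N
  refine h1.trans ?_
  calc _ ≤ Real.log 4 * ((N : ℝ) ^ (1 - s) / (1 - s)) :=
        mul_le_mul_of_nonneg_left (sum_Icc_rpow_neg_le hs0 hs N) (Real.log_nonneg (by norm_num))
    _ = _ := by ring

/-- A partial Euler product is a subsum of `ζ(σ)`, and `ζ(σ) ≤ 1 + 1/(σ-1)`. -/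
theorem sum_prime_neg_log_one_sub_rpow_le {σ : ℝ} (hσ : 1 < σ) (A : Finset ℕ) :
    ∑ p ∈ A with p.Prime, -Real.log (1 - (p : ℝ) ^ (-σ)) ≤ Real.log (1 + 1 / (σ - 1)) := by
  have hσ1 : 0 < σ - 1 := by linarith
  let f : ℕ →* ℝ :=
    { toFun := fun n => (n : ℝ) ^ (-σ)
      map_one' := by simp
      map_mul' := fun m n => by
        push_cast
        exact Real.mul_rpow m.cast_nonneg n.cast_nonneg }
  have hf0 (n : ℕ) : 0 ≤ f n := Real.rpow_nonneg n.cast_nonneg _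
  have hsum : Summable f := Real.summable_nat_rpow.mpr (by linarith)
  have hle : ∑' n, f n ≤ 1 + 1 / (σ - 1) := by
    refine Real.tsum_le_of_sum_range_le hf0 fun N => ?_
    have h1 : ∑ n ∈ Finset.range N, f n ≤ ∑ n ∈ Finset.Icc 0 (N + 1), f n :=
      Finset.sum_le_sum_of_subset_of_nonneg (fun n hn => by
        rw [Finset.mem_range] at hn
        exact Finset.mem_Icc.mpr ⟨n.zero_le, by omega⟩) fun n _ _ => hf0 n
    have hz : f 0 = 0 := by
      change ((0 : ℕ) : ℝ) ^ (-σ) = 0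
      rw [Nat.cast_zero, Real.zero_rpow (by linarith)]
    have h2 : ∑ n ∈ Finset.Icc 0 (N + 1), f n = 1 + ∑ n ∈ Finset.Ioc 1 (N + 1), f n := by
      rw [← Finset.sum_Ioc_add_eq_sum_Icc (Nat.zero_le _), hz, add_zero,
        ← Finset.sum_Ioc_consecutive _ (Nat.zero_le 1) (by omega : 1 ≤ N + 1)]
      congr 1
      simp
    have h3 := sum_Ioc_rpow_neg_le hσ (y := 1) (N := N + 1) le_rfl
    rw [Nat.cast_one, Real.one_rpow] at h3
    rw [h2] at h1
    exact h1.trans (add_le_add_right h3 1)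
  have hlt {p : ℕ} (hp : p.Prime) : (p : ℝ) ^ (-σ) < 1 :=
    (rpow_neg_mem_Ico (by linarith) hp).2
  have hprod := EulerProduct.prod_filter_prime_geometric_eq_tsum_factoredNumbers hsum A
  have h4 : ∏ p ∈ A with p.Prime, (1 - (p : ℝ) ^ (-σ))⁻¹ ≤ 1 + 1 / (σ - 1) :=
    hprod.le.trans ((hsum.tsum_subtype_le _ _ hf0).trans hle)
  have hpos (p : ℕ) (hp : p ∈ A.filter Nat.Prime) : 0 < 1 - (p : ℝ) ^ (-σ) := by
    linarith [hlt (Finset.mem_filter.mp hp).2]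
  have h5 : ∑ p ∈ A with p.Prime, -Real.log (1 - (p : ℝ) ^ (-σ))
      = Real.log (∏ p ∈ A with p.Prime, (1 - (p : ℝ) ^ (-σ))⁻¹) := by
    rw [Real.log_prod fun p hp => (inv_pos.mpr (hpos p hp)).ne']
    exact Finset.sum_congr rfl fun p _ => (Real.log_inv _).symm
  rw [h5]
  exact Real.log_le_log (Finset.prod_pos fun p hp => inv_pos.mpr (hpos p hp)) h4

/-! ### Mertens' theorems: `∑ log p / p` from `log N!`, then the product over primes. -/

theorem log_factorial_eq_sum (N : ℕ) : Real.log (N.factorial : ℝ)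
    = ∑ p ∈ Finset.Icc 1 N with p.Prime, (N.factorial.factorization p : ℝ) * Real.log p := by
  rw [natCast_eq_prod_pow_factorization N.factorial_ne_zero
    (S := (Finset.Icc 1 N).filter Nat.Prime), Real.log_prod]
  · exact Finset.sum_congr rfl fun p _ => Real.log_pow _ _
  · intro p hp
    have : (p : ℝ) ≠ 0 := by exact_mod_cast (Finset.mem_filter.mp hp).2.ne_zero
    positivity
  · intro p hp
    have hp' := Nat.prime_of_mem_primeFactors hp
    exact Finset.mem_filter.mpr ⟨Finset.mem_Icc.mpr
      ⟨hp'.one_le, hp'.dvd_factorial.mp (Nat.dvd_of_mem_primeFactors hp)⟩, hp'⟩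

/-- The exponent of `p` in `N!` exceeds `N/p - 1`, while `N! ≤ N^N`; the loss `∑ log p` is `θ(N)`.
-/
theorem sum_prime_log_div_le {N : ℕ} (hN : 1 ≤ N) :
    ∑ p ∈ Finset.Icc 1 N with p.Prime, Real.log p / p ≤ Real.log N + Real.log 4 := by
  have hN0 : (0 : ℝ) < N := by exact_mod_cast hN
  have h1 : Real.log (N.factorial : ℝ) ≤ N * Real.log N := by
    rw [← Real.log_pow]
    exact Real.log_le_log (by positivity) (by exact_mod_cast N.factorial_le_pow)
  have h2 : ∑ p ∈ Finset.Icc 1 N with p.Prime, ((N : ℝ) / p - 1) * Real.log p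
      ≤ Real.log (N.factorial : ℝ) := by
    rw [log_factorial_eq_sum]
    refine Finset.sum_le_sum fun p hp => mul_le_mul_of_nonneg_right ?_ (Real.log_natCast_nonneg p)
    rw [Finset.mem_filter, Finset.mem_Icc] at hp
    have h3 : N / p ≤ N.factorial.factorization p := by
      rw [Nat.factorization_factorial hp.2 (b := Nat.log p N + 2) (by omega)]
      have := Finset.single_le_sum (f := fun i => N / p ^ i) (fun _ _ => Nat.zero_le _)
        (Finset.mem_Ico.mpr ⟨le_rfl, by omega⟩ : 1 ∈ Finset.Ico 1 (Nat.log p N + 2))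
      simpa using this
    have h4 : (N : ℝ) / p < (N / p : ℕ) + 1 := by
      rw [← Nat.floor_div_eq_div (K := ℝ)]
      exact Nat.lt_floor_add_one _
    have h5 : ((N / p : ℕ) : ℝ) ≤ N.factorial.factorization p := by exact_mod_cast h3
    linarith
  have h3 := Chebyshev.theta_le_log4_mul_x (x := (N : ℕ)) (Nat.cast_nonneg _)
  rw [Chebyshev.theta, Nat.floor_natCast] at h3
  change ∑ p ∈ Finset.Icc 1 N with p.Prime, Real.log p ≤ _ at h3
  have h4 : ∑ p ∈ Finset.Icc 1 N with p.Prime, ((N : ℝ) / p - 1) * Real.log p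
      = N * ∑ p ∈ Finset.Icc 1 N with p.Prime, Real.log p / p
        - ∑ p ∈ Finset.Icc 1 N with p.Prime, Real.log p := by
    rw [Finset.mul_sum, ← Finset.sum_sub_distrib]
    exact Finset.sum_congr rfl fun p _ => by ring
  refine le_of_mul_le_mul_left (a := (N : ℝ)) ?_ hN0
  linarith

theorem sum_prime_log_mul_rpow_neg_two_le (N : ℕ) :
    ∑ p ∈ Finset.Icc 1 N with p.Prime, Real.log p * (p : ℝ) ^ (-2 : ℝ) ≤ 2 * Real.log 4 := by
  have h := sum_prime_Ioc_log_mul_rpow_neg_le (s := 2) one_lt_two (y := 1) (N := N) le_rfl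
  have e : (Finset.Icc 1 N).filter Nat.Prime = (Finset.Ioc 1 N).filter Nat.Prime := by
    ext p
    simp only [Finset.mem_filter, Finset.mem_Icc, Finset.mem_Ioc]
    exact ⟨fun ⟨h, hp⟩ => ⟨⟨hp.one_lt, h.2⟩, hp⟩, fun ⟨h, hp⟩ => ⟨⟨h.1.le, h.2⟩, hp⟩⟩
  rw [e]
  refine h.trans (le_of_eq ?_)
  rw [Nat.cast_one, Real.one_rpow]
  ring

/-- Here `N! ≥ (N/e)^N`, and the exponent of `p` is at most `N/(p-1) ≤ N (1/p + 2/p²)`; the `1/p²`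
part sums to a bounded quantity. -/
theorem le_sum_prime_log_div {N : ℕ} (hN : 1 ≤ N) :
    Real.log N - (1 + 4 * Real.log 4) ≤ ∑ p ∈ Finset.Icc 1 N with p.Prime, Real.log p / p := by
  have hN0 : (0 : ℝ) < N := by exact_mod_cast hN
  have h1 : N * Real.log N - N ≤ Real.log (N.factorial : ℝ) := by
    have := Real.log_le_log (by positivity) (Real.pow_div_factorial_le_exp _ hN0.le N)
    rw [Real.log_exp, Real.log_div (by positivity) (by positivity), Real.log_pow] at this
    linarith
  have h2 : Real.log (N.factorial : ℝ) ≤ ∑ p ∈ Finset.Icc 1 N with p.Prime,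
      (N * (Real.log p / p) + N * (2 * (Real.log p * (p : ℝ) ^ (-2 : ℝ)))) := by
    rw [log_factorial_eq_sum]
    refine Finset.sum_le_sum fun p hp => ?_
    rw [Finset.mem_filter, Finset.mem_Icc] at hp
    have hp2 : (2 : ℝ) ≤ p := by exact_mod_cast hp.2.two_le
    have h3 : (N.factorial.factorization p : ℝ) ≤ N / (p - 1) := by
      have h4 : (N.factorial.factorization p : ℝ) ≤ (N / (p - 1) : ℕ) := by
        exact_mod_cast Nat.factorization_factorial_le_div_pred hp.2 N
      refine h4.trans (Nat.cast_div_le.trans_eq ?_)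
      rw [Nat.cast_sub hp.2.one_le, Nat.cast_one]
    have h5 : (N : ℝ) / (p - 1) ≤ N * (1 / p + 2 * (1 / p ^ 2)) := by
      rw [div_eq_mul_one_div]
      refine mul_le_mul_of_nonneg_left ?_ hN0.le
      rw [div_le_iff₀ (by linarith)]
      have : (1 / (p : ℝ) + 2 * (1 / p ^ 2)) * (p - 1) = 1 + (p - 2) / p ^ 2 := by
        field_simp; ring
      rw [this]
      have : 0 ≤ ((p : ℝ) - 2) / p ^ 2 := div_nonneg (by linarith) (by positivity)
      linarith
    have h6 : (p : ℝ) ^ (-2 : ℝ) = 1 / p ^ 2 := by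
      rw [Real.rpow_neg (by positivity), Real.rpow_two, one_div]
    rw [h6]
    calc _ ≤ N * (1 / p + 2 * (1 / p ^ 2)) * Real.log p :=
          mul_le_mul_of_nonneg_right (h3.trans h5) (Real.log_natCast_nonneg p)
      _ = _ := by ring
  rw [Finset.sum_add_distrib, ← Finset.mul_sum, ← Finset.mul_sum, ← Finset.mul_sum] at h2
  have h3 := mul_le_mul_of_nonneg_left (sum_prime_log_mul_rpow_neg_two_le N) hN0.le
  refine le_of_mul_le_mul_left (a := (N : ℝ)) ?_ hN0
  linarith

theorem one_le_floor_exp {v : ℝ} (hv : 0 ≤ v) : 1 ≤ ⌊Real.exp v⌋₊ :=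
  Nat.one_le_floor_iff _ |>.mpr (Real.one_le_exp hv)

theorem log_floor_exp_le {v : ℝ} (hv : 0 ≤ v) : Real.log (⌊Real.exp v⌋₊ : ℝ) ≤ v := by
  rw [Real.log_le_iff_le_exp (by exact_mod_cast one_le_floor_exp hv)]
  exact Nat.floor_le (Real.exp_pos v).le

theorem le_log_floor_exp {v : ℝ} (hv : 0 ≤ v) :
    v - Real.log 2 ≤ Real.log (⌊Real.exp v⌋₊ : ℝ) := by
  have h1 : (1 : ℝ) ≤ ⌊Real.exp v⌋₊ := by exact_mod_cast one_le_floor_exp hv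
  have h2 := Nat.lt_floor_add_one (Real.exp v)
  have h3 : Real.exp v ≤ 2 * (⌊Real.exp v⌋₊ : ℝ) := by linarith
  have h4 := Real.log_le_log (Real.exp_pos v) h3
  rw [Real.log_exp, Real.log_mul (by norm_num) (by linarith)] at h4
  linarith

theorem filter_prime_log_le {N : ℕ} {T v : ℝ} (hN : N = ⌊Real.exp T⌋₊) (M : ℕ) :
    (((Finset.Ioc M N).filter Nat.Prime).filter fun p : ℕ => Real.log (p : ℝ) ≤ v)
      = (Finset.Ioc M ⌊Real.exp (min v T)⌋₊).filter Nat.Prime := by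
  ext p
  simp only [Finset.mem_filter, Finset.mem_Ioc, hN]
  constructor
  · rintro ⟨⟨⟨h1, h2⟩, hp⟩, h4⟩
    refine ⟨⟨h1, Nat.le_floor ?_⟩, hp⟩
    have hp0 : (0 : ℝ) < p := by exact_mod_cast hp.pos
    rw [Nat.le_floor_iff (Real.exp_pos _).le] at h2
    rw [← Real.log_le_iff_le_exp hp0] at h2 ⊢
    exact le_min h4 h2
  · rintro ⟨⟨h1, h2⟩, hp⟩
    have hp0 : (0 : ℝ) < p := by exact_mod_cast hp.pos
    rw [Nat.le_floor_iff (Real.exp_pos _).le, ← Real.log_le_iff_le_exp hp0] at h2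
    refine ⟨⟨⟨h1, Nat.le_floor ?_⟩, hp⟩, h2.trans (min_le_left _ _)⟩
    rw [← Real.log_le_iff_le_exp hp0]
    exact h2.trans (min_le_right _ _)

theorem sum_filter_disjSum (A B : Finset ℕ) (w₁ w₂ u₁ u₂ : ℕ → ℝ) (v : ℝ) :
    ∑ i ∈ A.disjSum B with Sum.elim u₁ u₂ i ≤ v, Sum.elim w₁ w₂ i
      = ∑ i ∈ A with u₁ i ≤ v, w₁ i + ∑ i ∈ B with u₂ i ≤ v, w₂ i := by
  rw [Finset.sum_filter, Finset.sum_disjSum, Finset.sum_filter, Finset.sum_filter]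
  rfl

/-- Up to the scale `exp T`, the logarithms of the primes with weights `log p / p` are not denser
than the positive integers. -/
theorem sum_prime_log_div_mul_le {g : ℝ → ℝ} (hg : AntitoneOn g (Set.Ioi 0)) {G : ℝ}
    (h0 : ∀ x, 0 < x → 0 ≤ g x ∧ g x ≤ G) (T : ℕ) :
    ∑ p ∈ Finset.Icc 1 ⌊Real.exp T⌋₊ with p.Prime, Real.log p / p * g (Real.log p)
      ≤ ∑ m ∈ Finset.Icc 1 T, g m + (1 + Real.log 4) * G := by
  have hlog4 : 0 ≤ Real.log 4 := Real.log_nonneg (by norm_num)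
  have hG : 0 ≤ G := (h0 1 one_pos).1.trans (h0 1 one_pos).2
  set N := ⌊Real.exp T⌋₊ with hN
  -- Primes, placed at `log p` with weight `log p / p`, and integers, placed at `m` with weight
  -- `-1`, are merged into one signed sum. Mertens' first theorem bounds its partial sums.
  have h := (((Finset.Icc 1 N).filter Nat.Prime).disjSum (Finset.Icc 1 T)).sum_mul_antitoneOn_le
    (Sum.elim (fun p : ℕ => Real.log p / p) (fun _ : ℕ => (-1 : ℝ)))
    (Sum.elim (fun p : ℕ => Real.log p) (fun m : ℕ => (m : ℝ))) (s := Set.Ioi 0) (g := g)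
    (by
      rintro (p | m) hi
      · rw [Finset.inl_mem_disjSum, Finset.mem_filter] at hi
        exact Real.log_pos (by exact_mod_cast hi.2.one_lt)
      · rw [Finset.inr_mem_disjSum, Finset.mem_Icc] at hi
        simp only [Sum.elim_inr, Set.mem_Ioi]
        exact_mod_cast hi.1) hg (C := 1 + Real.log 4) (by positivity) hG h0
    (fun v => by
      rw [sum_filter_disjSum]
      change ∑ p ∈ ((Finset.Ioc 0 N).filter Nat.Prime).filter _, _ + _ ≤ _
      rw [filter_prime_log_le hN]
      rcases lt_or_ge v 0 with hv | hv
      · have h1 : ⌊Real.exp (min v T)⌋₊ = 0 := by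
          rw [Nat.floor_eq_zero, Real.exp_lt_one_iff]
          exact (min_le_left _ _).trans_lt hv
        rw [h1, Finset.sum_const]
        simp only [Finset.Ioc_self, Finset.filter_empty, Finset.sum_empty, nsmul_eq_mul]
        have : (0 : ℝ) ≤ ((Finset.Icc 1 T).filter fun m : ℕ => (m : ℝ) ≤ v).card :=
          Nat.cast_nonneg _
        linarith
      · have hv' : 0 ≤ min v T := le_min hv T.cast_nonneg
        have h1 := sum_prime_log_div_le (one_le_floor_exp hv')
        have h2 := log_floor_exp_le hv'
        have hf : (Finset.Icc 1 T).filter (fun m : ℕ => (m : ℝ) ≤ v)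
            = Finset.Icc 1 ⌊min v T⌋₊ := by
          ext m
          simp only [Finset.mem_filter, Finset.mem_Icc, Nat.le_floor_iff hv', le_min_iff,
            Nat.cast_le]
          tauto
        rw [hf, Finset.sum_const, Nat.card_Icc, Nat.add_sub_cancel, nsmul_eq_mul]
        have h3 := Nat.lt_floor_add_one (min v T)
        change ∑ p ∈ Finset.Icc 1 ⌊Real.exp (min v T)⌋₊ with p.Prime, Real.log p / p + _ ≤ _
        linarith)
  rw [Finset.sum_disjSum] at h
  simp only [Sum.elim_inl, Sum.elim_inr, neg_one_mul, Finset.sum_neg_distrib] at h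
  linarith

/-- Between the scales `exp T` and `exp U`, the logarithms of the primes with weights `log p / p`
are not sparser than the integers. -/
theorem sum_Ioc_le_sum_prime_log_div_mul {T U : ℕ} (hTU : T ≤ U) {g : ℝ → ℝ}
    (hg : AntitoneOn g (Set.Ici (T : ℝ))) {G : ℝ} (h0 : ∀ x, (T : ℝ) ≤ x → 0 ≤ g x ∧ g x ≤ G) :
    ∑ m ∈ Finset.Ioc T U, g m
      ≤ ∑ p ∈ Finset.Ioc ⌊Real.exp T⌋₊ ⌊Real.exp U⌋₊ with p.Prime,
          Real.log p / p * g (Real.log p) + (2 + 6 * Real.log 4) * G := by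
  have hlog4 : 0 ≤ Real.log 4 := Real.log_nonneg (by norm_num)
  have hlog2 : Real.log 2 ≤ Real.log 4 := Real.log_le_log (by norm_num) (by norm_num)
  have hG : 0 ≤ G := (h0 T le_rfl).1.trans (h0 T le_rfl).2
  set M := ⌊Real.exp T⌋₊ with hM
  set N := ⌊Real.exp U⌋₊ with hN
  have h := (((Finset.Ioc M N).filter Nat.Prime).disjSum (Finset.Ioc T U)).sum_mul_antitoneOn_le
    (Sum.elim (fun p : ℕ => -(Real.log p / p)) (fun _ : ℕ => (1 : ℝ)))
    (Sum.elim (fun p : ℕ => Real.log p) (fun m : ℕ => (m : ℝ))) (s := Set.Ici (T : ℝ)) (g := g)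
    (by
      rintro (p | m) hi
      · rw [Finset.inl_mem_disjSum, Finset.mem_filter, Finset.mem_Ioc, hM,
          Nat.floor_lt (Real.exp_pos _).le] at hi
        rw [Sum.elim_inl, Set.mem_Ici, Real.le_log_iff_exp_le (by exact_mod_cast hi.2.pos)]
        exact hi.1.1.le
      · rw [Finset.inr_mem_disjSum, Finset.mem_Ioc] at hi
        simp only [Sum.elim_inr, Set.mem_Ici]
        exact_mod_cast hi.1.le) hg (C := 2 + 6 * Real.log 4) (by positivity) hG h0
    (fun v => by
      rw [sum_filter_disjSum, filter_prime_log_le hN]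
      rcases lt_or_ge v T with hv | hv
      · rw [Finset.sum_neg_distrib, Finset.filter_false_of_mem (s := Finset.Ioc T U)]
        · have : 0 ≤ ∑ p ∈ Finset.Ioc M ⌊Real.exp (min v U)⌋₊ with p.Prime,
              Real.log p / p :=
            Finset.sum_nonneg fun p _ => div_nonneg (Real.log_natCast_nonneg p) p.cast_nonneg
          rw [Finset.sum_empty]
          linarith
        · intro m hm hmv
          have : (T : ℝ) < m := by exact_mod_cast (Finset.mem_Ioc.mp hm).1
          linarith
      · have hTv : (T : ℝ) ≤ min v U := le_min hv (by exact_mod_cast hTU)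
        have hv' : 0 ≤ min v U := le_trans T.cast_nonneg hTv
        have h1 := le_sum_prime_log_div (one_le_floor_exp hv')
        have h2 := le_log_floor_exp hv'
        have h1' := sum_prime_log_div_le (one_le_floor_exp (T.cast_nonneg (α := ℝ)))
        have h2' := log_floor_exp_le (T.cast_nonneg (α := ℝ))
        have hf : (Finset.Ioc T U).filter (fun m : ℕ => (m : ℝ) ≤ v)
            = Finset.Ioc T ⌊min v U⌋₊ := by
          ext m
          simp only [Finset.mem_filter, Finset.mem_Ioc, Nat.le_floor_iff hv', le_min_iff,
            Nat.cast_le]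
          tauto
        have hTf : T ≤ ⌊min v U⌋₊ := Nat.le_floor hTv
        rw [hf, Finset.sum_const, Nat.card_Ioc, nsmul_eq_mul, Nat.cast_sub hTf,
          Finset.sum_neg_distrib]
        have h3 := Nat.floor_le hv'
        have hMN : M ≤ ⌊Real.exp (min v U)⌋₊ := Nat.floor_le_floor (Real.exp_le_exp.mpr hTv)
        have h4 := Finset.sum_Ioc_consecutive
          (fun p : ℕ => if p.Prime then Real.log p / p else 0) (Nat.zero_le M) hMN
        simp only [← Finset.sum_filter] at h4
        change ∑ p ∈ Finset.Icc 1 M with p.Prime, Real.log p / p + _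
          = ∑ p ∈ Finset.Icc 1 ⌊Real.exp (min v U)⌋₊ with p.Prime, Real.log p / p at h4
        linarith)
  rw [Finset.sum_disjSum] at h
  simp only [Sum.elim_inl, Sum.elim_inr, one_mul, neg_mul, Finset.sum_neg_distrib] at h
  linarith

/-- Convexity of `exp`: up to sign, this is the slope of a chord issuing from the origin of the
`u`-axis. -/
theorem antitoneOn_one_sub_exp_neg_div {s : ℝ} (hs : 0 < s) :
    AntitoneOn (fun u => (1 - Real.exp (-(s * u))) / u) (Set.Ioi 0) := by
  intro a ha b hb hab
  have ha : 0 < a := ha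
  have hb : 0 < b := hb
  have h := convexOn_exp.2 (Set.mem_univ (-(s * b))) (Set.mem_univ 0)
    (show 0 ≤ a / b by positivity) (show 0 ≤ 1 - a / b by
      rw [sub_nonneg, div_le_one hb]; exact hab) (by ring)
  have e : a / b * -(s * b) = -(s * a) := by field_simp
  simp only [smul_eq_mul, mul_zero, add_zero, Real.exp_zero, mul_one, e] at h
  rw [div_le_div_iff₀ hb ha]
  have h2 := mul_le_mul_of_nonneg_left h hb.le
  have e2 : b * (a / b * Real.exp (-(s * b)) + (1 - a / b))
      = a * Real.exp (-(s * b)) + b - a := by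
    field_simp
    ring
  rw [e2] at h2
  linarith

theorem antitoneOn_exp_neg_div {s : ℝ} (hs : 0 < s) :
    AntitoneOn (fun u => Real.exp (-(s * u)) / u) (Set.Ioi 0) := by
  intro a ha b hb hab
  have ha : 0 < a := ha
  exact div_le_div₀ (Real.exp_pos _).le
    (Real.exp_le_exp.mpr (neg_le_neg (mul_le_mul_of_nonneg_left hab hs.le))) ha hab

theorem natCast_rpow_neg_eq_exp {p : ℕ} (hp : p.Prime) (s : ℝ) :
    (p : ℝ) ^ (-s) = Real.exp (-(s * Real.log p)) := by
  rw [Real.rpow_def_of_pos (by exact_mod_cast hp.pos)]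
  ring_nf

/-- The difference `-log (1 - x) - x` at `x = 1 / p` and at `x = p ^ (-(1 + s))`. -/
theorem neg_log_one_sub_inv_sub_le {s : ℝ} (hs : 0 < s) {p : ℕ} (hp : p.Prime) :
    -Real.log (1 - 1 / p) - 1 / p ≤ -Real.log (1 - (p : ℝ) ^ (-(1 + s))) - (p : ℝ) ^ (-(1 + s))
      + 2 * s * (Real.log p * (p : ℝ) ^ (-2 : ℝ)) := by
  have hp2 : (2 : ℝ) ≤ p := by exact_mod_cast hp.two_le
  have hp0 : (0 : ℝ) < p := by linarith
  have h6 : (p : ℝ) ^ (-2 : ℝ) = 1 / p * (1 / p) := by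
    rw [Real.rpow_neg hp0.le, Real.rpow_two]
    field_simp
  have hx' : (p : ℝ) ^ (-(1 + s)) = 1 / p * (p : ℝ) ^ (-s) := by
    rw [show -(1 + s) = -1 + -s by ring, Real.rpow_add hp0, Real.rpow_neg_one, one_div]
  set x : ℝ := 1 / p with hx
  have hx0 : 0 < x := by positivity
  have hx12 : x ≤ 1 / 2 := one_div_le_one_div_of_le two_pos hp2
  set x' : ℝ := (p : ℝ) ^ (-(1 + s)) with hx'def
  have hlow : 1 - s * Real.log p ≤ (p : ℝ) ^ (-s) := by
    rw [natCast_rpow_neg_eq_exp hp]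
    linarith [Real.add_one_le_exp (-(s * Real.log p))]
  have hle1 : (p : ℝ) ^ (-s) ≤ 1 :=
    Real.rpow_le_one_of_one_le_of_nonpos (by linarith) (by linarith)
  have hxx : x' ≤ x := by rw [hx']; nlinarith
  have hd : x - x' ≤ x * (s * Real.log p) := by rw [hx']; nlinarith
  -- After subtracting `x - x'`, what remains is exactly `(x - x') x / (1 - x)`, of second order in
  -- `1/p`.
  have h1 : Real.log ((1 - x') / (1 - x)) ≤ (1 - x') / (1 - x) - 1 :=
    Real.log_le_sub_one_of_pos (div_pos (by linarith) (by linarith))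
  rw [Real.log_div (by linarith) (by linarith)] at h1
  have h2 : (1 - x') / (1 - x) - 1 - (x - x') = (x - x') * (x / (1 - x)) := by
    have : (1 - x) ≠ 0 := by linarith
    field_simp
    ring
  have h3 : x / (1 - x) ≤ 2 * x := by
    rw [div_le_iff₀ (by linarith)]
    nlinarith
  have h4 : (x - x') * (x / (1 - x)) ≤ (x * (s * Real.log p)) * (2 * x) :=
    mul_le_mul hd h3 (div_nonneg hx0.le (by linarith))
      (mul_nonneg hx0.le (mul_nonneg hs.le (Real.log_natCast_nonneg p)))
  rw [h6]
  linarith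

theorem le_neg_log_one_sub {x : ℝ} (hx : x < 1) : x ≤ -Real.log (1 - x) := by
  linarith [Real.log_le_sub_one_of_pos (show 0 < 1 - x by linarith)]

/-- A form of the upper bound in Mertens' product theorem. -/
theorem sum_prime_neg_log_one_sub_inv_le {T : ℕ} (hT : 1 ≤ T) :
    ∑ p ∈ Finset.Icc 1 ⌊Real.exp T⌋₊ with p.Prime, -Real.log (1 - 1 / (p : ℝ))
      ≤ ∑ m ∈ Finset.Icc 1 T, 1 / (m : ℝ) + (4 + 11 * Real.log 4) / T := by
  have hT0 : (0 : ℝ) < T := by exact_mod_cast hT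
  have hT1 : (1 : ℝ) ≤ T := by exact_mod_cast hT
  set s : ℝ := 1 / T with hs
  have hs0 : 0 < s := by positivity
  set y := ⌊Real.exp T⌋₊ with hy
  have hlog4 : 0 ≤ Real.log 4 := Real.log_nonneg (by norm_num)
  -- The Euler product at `1 + s` is known. Passing from `1/p` to `p^(-1-s)` below `exp T`, and
  -- discarding the primes between `exp T` and `exp U`, are both compared with the same operations
  -- on `1/m`. Each comparison costs a constant times `s = 1/T`.
  have main (U : ℕ) (hTU : T ≤ U) :
      ∑ p ∈ Finset.Icc 1 y with p.Prime, -Real.log (1 - 1 / (p : ℝ))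
        ≤ Real.log (1 + 1 / s) + ∑ m ∈ Finset.Icc 1 T, 1 / (m : ℝ)
          - ∑ m ∈ Finset.Icc 1 U, Real.exp (-(s * m)) / m + (3 + 11 * Real.log 4) / T := by
    set Y := ⌊Real.exp U⌋₊ with hY
    have hyY : y ≤ Y := Nat.floor_le_floor (Real.exp_le_exp.mpr (by exact_mod_cast hTU))
    have a1 := sum_prime_log_div_mul_le (antitoneOn_one_sub_exp_neg_div hs0) (G := s)
      (fun x hx => by
        constructor
        · exact div_nonneg (by rw [sub_nonneg, Real.exp_le_one_iff]; nlinarith) hx.le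
        · rw [div_le_iff₀ hx]
          linarith [Real.add_one_le_exp (-(s * x))]) T
    have a2 := sum_Ioc_le_sum_prime_log_div_mul hTU
      ((antitoneOn_exp_neg_div hs0).mono fun x hx => hT0.trans_le hx) (G := s)
      (fun x hx => by
        have hx0 : 0 < x := hT0.trans_le hx
        constructor
        · positivity
        · exact div_le_div₀ zero_le_one (Real.exp_le_one_iff.mpr (by nlinarith)) hT0 hx)
    have a3 := sum_prime_neg_log_one_sub_rpow_le (σ := 1 + s) (by linarith) (Finset.Icc 1 Y)
    rw [add_sub_cancel_left] at a3
    have a4 : ∑ p ∈ Finset.Icc 1 y with p.Prime, (-Real.log (1 - 1 / (p : ℝ)) - 1 / p)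
        ≤ ∑ p ∈ Finset.Icc 1 y with p.Prime,
            (-Real.log (1 - (p : ℝ) ^ (-(1 + s))) - (p : ℝ) ^ (-(1 + s)))
          + 2 * s * (2 * Real.log 4) := by
      calc _ ≤ ∑ p ∈ Finset.Icc 1 y with p.Prime,
            (-Real.log (1 - (p : ℝ) ^ (-(1 + s))) - (p : ℝ) ^ (-(1 + s))
              + 2 * s * (Real.log p * (p : ℝ) ^ (-2 : ℝ))) :=
            Finset.sum_le_sum fun p hp =>
              neg_log_one_sub_inv_sub_le hs0 (Finset.mem_filter.mp hp).2
        _ ≤ _ := by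
            rw [Finset.sum_add_distrib, ← Finset.mul_sum]
            gcongr
            exact sum_prime_log_mul_rpow_neg_two_le y
    have split (f : ℕ → ℝ) : ∑ p ∈ Finset.Icc 1 Y with p.Prime, f p
        = ∑ p ∈ Finset.Icc 1 y with p.Prime, f p + ∑ p ∈ Finset.Ioc y Y with p.Prime, f p := by
      have := Finset.sum_Ioc_consecutive (fun p : ℕ => if p.Prime then f p else 0)
        (Nat.zero_le y) hyY
      simp only [← Finset.sum_filter] at this
      exact this.symm
    have a5 : ∑ p ∈ Finset.Icc 1 y with p.Prime, -Real.log (1 - (p : ℝ) ^ (-(1 + s)))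
        + ∑ p ∈ Finset.Ioc y Y with p.Prime, (p : ℝ) ^ (-(1 + s)) ≤ Real.log (1 + 1 / s) := by
      refine le_trans ?_ a3
      rw [split]
      refine add_le_add_right (Finset.sum_le_sum fun p hp => le_neg_log_one_sub ?_) _
      exact (rpow_neg_mem_Ico (by linarith) (Finset.mem_filter.mp hp).2).2
    have a6 : ∑ p ∈ Finset.Icc 1 y with p.Prime,
          Real.log p / p * ((1 - Real.exp (-(s * Real.log p))) / Real.log p)
        = ∑ p ∈ Finset.Icc 1 y with p.Prime, 1 / (p : ℝ)
          - ∑ p ∈ Finset.Icc 1 y with p.Prime, (p : ℝ) ^ (-(1 + s)) := by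
      rw [← Finset.sum_sub_distrib]
      refine Finset.sum_congr rfl fun p hp => ?_
      have hp' := (Finset.mem_filter.mp hp).2
      have hp0 : (0 : ℝ) < p := by exact_mod_cast hp'.pos
      have hlp : Real.log p ≠ 0 := (Real.log_pos (by exact_mod_cast hp'.one_lt)).ne'
      rw [← natCast_rpow_neg_eq_exp hp', show -(1 + s) = -1 + -s by ring, Real.rpow_add hp0,
        Real.rpow_neg_one]
      field_simp
    have a7 : ∑ p ∈ Finset.Ioc y Y with p.Prime,
          Real.log p / p * (Real.exp (-(s * Real.log p)) / Real.log p)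
        = ∑ p ∈ Finset.Ioc y Y with p.Prime, (p : ℝ) ^ (-(1 + s)) := by
      refine Finset.sum_congr rfl fun p hp => ?_
      have hp' := (Finset.mem_filter.mp hp).2
      have hp0 : (0 : ℝ) < p := by exact_mod_cast hp'.pos
      have hlp : Real.log p ≠ 0 := (Real.log_pos (by exact_mod_cast hp'.one_lt)).ne'
      rw [← natCast_rpow_neg_eq_exp hp', show -(1 + s) = -1 + -s by ring, Real.rpow_add hp0,
        Real.rpow_neg_one]
      field_simp
    have a8 : ∑ m ∈ Finset.Icc 1 U, Real.exp (-(s * m)) / (m : ℝ)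
        = ∑ m ∈ Finset.Icc 1 T, Real.exp (-(s * m)) / (m : ℝ)
          + ∑ m ∈ Finset.Ioc T U, Real.exp (-(s * m)) / (m : ℝ) :=
      (Finset.sum_Ioc_consecutive _ (Nat.zero_le T) hTU).symm
    have a9 : ∑ m ∈ Finset.Icc 1 T, (1 - Real.exp (-(s * m))) / (m : ℝ)
        = ∑ m ∈ Finset.Icc 1 T, 1 / (m : ℝ)
          - ∑ m ∈ Finset.Icc 1 T, Real.exp (-(s * m)) / (m : ℝ) := by
      rw [← Finset.sum_sub_distrib]
      exact Finset.sum_congr rfl fun m _ => sub_div _ _ _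
    rw [Finset.sum_sub_distrib, Finset.sum_sub_distrib] at a4
    have a10 : (3 + 11 * Real.log 4) / T = (3 + 11 * Real.log 4) * s := by rw [hs]; ring
    rw [a10]
    linarith
  have hlim : Tendsto (fun U : ℕ => ∑ m ∈ Finset.Icc 1 U, Real.exp (-(s * m)) / (m : ℝ)) atTop
      (𝓝 (-Real.log (1 - Real.exp (-s)))) := by
    have hlt : |Real.exp (-s)| < 1 := by
      rw [abs_of_pos (Real.exp_pos _), Real.exp_lt_one_iff]
      linarith
    have := (Real.hasSum_pow_div_log_of_abs_lt_one hlt).tendsto_sum_nat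
    refine this.congr fun U => ?_
    have h := Finset.sum_Ico_add' (fun n : ℕ => Real.exp (-(s * n)) / (n : ℝ)) 0 U 1
    rw [zero_add] at h
    rw [Finset.range_eq_Ico, show Finset.Icc 1 U = Finset.Ico 1 (U + 1) from rfl, ← h]
    refine Finset.sum_congr rfl fun n _ => ?_
    rw [← Real.exp_nat_mul]
    push_cast
    ring_nf
  have hfin := ge_of_tendsto (((tendsto_const_nhds (x := Real.log (1 + 1 / s)
    + ∑ m ∈ Finset.Icc 1 T, 1 / (m : ℝ))).sub hlim).add_const ((3 + 11 * Real.log 4) / T))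
    (eventually_atTop.mpr ⟨T, main⟩)
  have hexp : 1 - Real.exp (-s) ≤ s := by linarith [Real.add_one_le_exp (-s)]
  have hexp0 : 0 < 1 - Real.exp (-s) := by
    rw [sub_pos, Real.exp_lt_one_iff]; linarith
  -- The pole of `ζ` at `1` cancels against `∑ e^(-sm)/m = -log(1 - e^(-s))`. Only the harmonic sum
  -- is left, and it supplies Euler's constant later.
  have h1 : Real.log (1 + 1 / s) + Real.log (1 - Real.exp (-s)) ≤ 1 / T := by
    calc _ ≤ Real.log (1 + 1 / s) + Real.log s :=
          add_le_add_right (Real.log_le_log hexp0 hexp) _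
      _ = Real.log ((1 + 1 / s) * s) := (Real.log_mul (by positivity) hs0.ne').symm
      _ ≤ (1 + 1 / s) * s - 1 := Real.log_le_sub_one_of_pos (by positivity)
      _ = 1 / T := by field_simp; rw [hs]; field_simp; ring
  calc _ ≤ _ := hfin
    _ ≤ ∑ m ∈ Finset.Icc 1 T, 1 / (m : ℝ) + (1 / T + (3 + 11 * Real.log 4) / T) := by linarith
    _ = _ := by ring

/-! ### The master inequality with parameters `l` and `y`, and interpolation in the exponent. -/

section interpolation

variable {k : ℕ}

/-- The `l`-th root of the moment bound, using the maximum of the kernel for `p ≤ y` and the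
exponent `l²` beyond. `N` only has to exceed the primes dividing the `n i`; the tail sum is later
bounded uniformly in `N`. -/
theorem exists_gcdSpectralNorm_le_exp {α : ℝ} (hα : 0 < α) (hk : 1 ≤ k) {n : Fin k → ℕ}
    (hn : Function.Injective n) (hn0 : ∀ i, 1 ≤ n i) {l : ℕ} (hl : l ≠ 0) (y : ℕ) :
    ∃ N, gcdSpectralNorm α n ≤ Real.exp (Real.log k / l
      + ∑ p ∈ Finset.Icc 1 y with p.Prime, Real.log ((1 + (p : ℝ) ^ (-α)) / (1 - (p : ℝ) ^ (-α)))
      + l * ∑ p ∈ Finset.Ioc y N with p.Prime, -Real.log (1 - (p : ℝ) ^ (-(2 * α)))) := by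
  have hn0' (i) : n i ≠ 0 := Nat.one_le_iff_ne_zero.mp (hn0 i)
  obtain ⟨l', rfl⟩ := Nat.exists_eq_succ_of_ne_zero hl
  set l := l' + 1 with hldef
  set N := max y (∏ i, n i) with hN
  refine ⟨N, ?_⟩
  set b : ℕ → ℝ := fun p => if p ≤ y then l * Real.log ((1 + (p : ℝ) ^ (-α)) / (1 - (p : ℝ) ^ (-α)))
    else (l : ℝ) ^ 2 * -Real.log (1 - (p : ℝ) ^ (-(2 * α))) with hb
  have hl0 : (l : ℝ) ≠ 0 := by positivity
  have hk0 : (0 : ℝ) < k := by exact_mod_cast hk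
  refine gcdSpectralNorm_le_of_moment hα hn hn0' (S := (Finset.Icc 1 N).filter Nat.Prime)
    (fun i p hp => ?_) (fun p hp => (Finset.mem_filter.mp hp).2) hl (Real.exp_pos _)
    (fun p => Real.exp (b p)) (fun p hp => ?_) (le_of_eq ?_)
  · have hp' := Nat.prime_of_mem_primeFactors hp
    refine Finset.mem_filter.mpr ⟨Finset.mem_Icc.mpr ⟨hp'.one_le, ?_⟩, hp'⟩
    have h1 : p ≤ n i := Nat.le_of_mem_primeFactors hp
    have h2 : n i ≤ ∏ i, n i :=
      Finset.single_le_prod' (f := n) (fun j _ => hn0 j) (Finset.mem_univ i)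
    exact (h1.trans h2).trans (le_max_right _ _)
  · obtain ⟨h0, h1⟩ := rpow_neg_mem_Ico hα (Finset.mem_filter.mp hp).2
    have hsq : ((p : ℝ) ^ (-α)) ^ 2 = (p : ℝ) ^ (-(2 * α)) := by
      rw [← Real.rpow_mul_natCast p.cast_nonneg]
      congr 1
      push_cast
      ring
    simp only [hb]
    split_ifs with hpy
    · rw [Real.exp_nat_mul, Real.exp_log (div_pos (by linarith) (by linarith))]
      exact integral_circlePoisson_pow_le_div_pow h0 h1 l
    · have h2 := integral_circlePoisson_pow_le h0 h1 l'
      have h3 : 0 < 1 - ((p : ℝ) ^ (-α)) ^ 2 := by nlinarith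
      rw [hsq] at h2 h3
      refine h2.trans (le_of_eq ?_)
      rw [← Real.log_inv, ← Nat.cast_pow, Real.exp_nat_mul, Real.exp_log (inv_pos.mpr h3)]
  · rw [← Real.exp_sum, ← Real.exp_nat_mul]
    nth_rw 1 [← Real.exp_log hk0]
    rw [← Real.exp_add]
    congr 1
    have hsplit := Finset.sum_Ioc_consecutive (fun p : ℕ => if p.Prime then b p else 0)
      (Nat.zero_le y) (le_max_left y (∏ i, n i))
    simp only [← Finset.sum_filter] at hsplit
    change _ = ∑ p ∈ Finset.Icc 1 N with p.Prime, b p at hsplit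
    have e1 : ∑ p ∈ Finset.Ioc 0 y with p.Prime, b p = l * ∑ p ∈ Finset.Icc 1 y with p.Prime,
        Real.log ((1 + (p : ℝ) ^ (-α)) / (1 - (p : ℝ) ^ (-α))) := by
      rw [Finset.mul_sum]
      refine Finset.sum_congr rfl fun p hp => ?_
      simp only [hb, if_pos (Finset.mem_Icc.mp (Finset.mem_filter.mp hp).1).2]
    have e2 : ∑ p ∈ Finset.Ioc y N with p.Prime, b p = (l : ℝ) ^ 2 *
        ∑ p ∈ Finset.Ioc y N with p.Prime, -Real.log (1 - (p : ℝ) ^ (-(2 * α))) := by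
      rw [Finset.mul_sum]
      refine Finset.sum_congr rfl fun p hp => ?_
      rw [Finset.mem_filter, Finset.mem_Ioc] at hp
      simp only [hb, if_neg (not_le.mpr hp.1.1)]
    rw [← hsplit, e1, e2]
    field_simp
    ring

theorem gcdMatrix_nonneg (α : ℝ) (n : Fin k → ℕ) (i j : Fin k) : 0 ≤ gcdMatrix α n i j := by
  unfold gcdMatrix; positivity

theorem norm_gcdForm_le (α : ℝ) (n : Fin k → ℕ) (c : EuclideanSpace ℂ (Fin k)) :
    ‖gcdForm α n c‖ ≤ ∑ i, ∑ j, gcdMatrix α n i j * (‖c i‖ * ‖c j‖) := by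
  unfold gcdForm
  refine (norm_sum_le _ _).trans (Finset.sum_le_sum fun i _ =>
    (norm_sum_le _ _).trans_eq (Finset.sum_congr rfl fun j _ => ?_))
  rw [norm_mul, norm_mul, RCLike.norm_conj, Complex.norm_real,
    Real.norm_of_nonneg (gcdMatrix_nonneg α n i j), mul_assoc]

theorem sum_norm_mul_norm_le {c : EuclideanSpace ℂ (Fin k)} (hc : ‖c‖ = 1) :
    ∑ i, ∑ j, ‖c i‖ * ‖c j‖ ≤ k := by
  rw [← Finset.sum_mul_sum, ← sq]
  have h : (∑ i, ‖c i‖) ^ 2 ≤ k * ∑ i, ‖c i‖ ^ 2 := by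
    simpa using sq_sum_le_card_mul_sum_sq (s := Finset.univ) (f := fun i => ‖c i‖)
  rwa [← EuclideanSpace.norm_sq_eq, hc, one_pow, mul_one] at h

/-- The moduli of the coordinates form another unit vector. As the entries are nonnegative, this
permits entrywise comparison of matrices. -/
theorem sum_gcdMatrix_mul_norm_le (α : ℝ) (n : Fin k → ℕ) {c : EuclideanSpace ℂ (Fin k)}
    (hc : ‖c‖ = 1) :
    ∑ i, ∑ j, gcdMatrix α n i j * (‖c i‖ * ‖c j‖) ≤ gcdSpectralNorm α n := by
  set d : EuclideanSpace ℂ (Fin k) := WithLp.toLp 2 fun i => ((‖c i‖ : ℝ) : ℂ) with hd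
  have hdc : ‖d‖ = 1 := by
    rw [← hc, EuclideanSpace.norm_eq, EuclideanSpace.norm_eq]
    simp [hd]
  refine le_of_eq_of_le ?_ (gcdForm_re_le_gcdSpectralNorm α n d hdc)
  have : gcdForm α n d = ((∑ i, ∑ j, gcdMatrix α n i j * (‖c i‖ * ‖c j‖) : ℝ) : ℂ) := by
    unfold gcdForm
    push_cast
    refine Finset.sum_congr rfl fun i _ => Finset.sum_congr rfl fun j _ => ?_
    simp [hd, mul_assoc]
  rw [this, Complex.ofReal_re]

theorem gcdMatrix_le_one {α : ℝ} (hα : 0 ≤ α) {n : Fin k → ℕ} (hn : ∀ i, 1 ≤ n i) (i j : Fin k) :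
    gcdMatrix α n i j ≤ 1 := by
  unfold gcdMatrix
  have hi : (0 : ℝ) < n i := by exact_mod_cast hn i
  have hj : (0 : ℝ) < n j := by exact_mod_cast hn j
  rw [div_le_one (by positivity), Real.rpow_mul (Nat.cast_nonneg _)]
  refine Real.rpow_le_rpow (by positivity) ?_ hα
  rw [Real.rpow_two, sq]
  gcongr
  · exact Nat.gcd_le_left _ (hn i)
  · exact Nat.gcd_le_right _ (hn j)

theorem gcdSpectralNorm_le_card {α : ℝ} (hα : 0 ≤ α) {n : Fin k → ℕ} (hn : ∀ i, 1 ≤ n i) :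
    gcdSpectralNorm α n ≤ k := by
  refine Real.sSup_le ?_ k.cast_nonneg
  rintro _ ⟨c, hc, rfl⟩
  refine (norm_gcdForm_le α n c).trans (le_trans ?_ (sum_norm_mul_norm_le hc))
  exact Finset.sum_le_sum fun i _ => Finset.sum_le_sum fun j _ =>
    mul_le_of_le_one_left (by positivity) (gcdMatrix_le_one hα hn i j)

theorem gcdMatrix_mul_exponent (α θ : ℝ) (n : Fin k → ℕ) (i j : Fin k) :
    gcdMatrix (α * θ) n i j = gcdMatrix α n i j ^ θ := by
  unfold gcdMatrix
  rw [Real.div_rpow (by positivity) (by positivity), ← Real.rpow_mul (by positivity),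
    ← Real.rpow_mul (by positivity), mul_assoc]

/-- Interpolation of the spectral norm between a given exponent and the exponent zero. -/
theorem gcdSpectralNorm_mul_le (hk : 1 ≤ k) {α θ V : ℝ} (hθ0 : 0 ≤ θ) (hθ1 : θ ≤ 1)
    (hV : 0 < V) {n : Fin k → ℕ} (h : gcdSpectralNorm α n ≤ V) :
    gcdSpectralNorm (α * θ) n ≤ V ^ θ * (k : ℝ) ^ (1 - θ) := by
  have hk0 : (0 : ℝ) < k := by exact_mod_cast hk
  refine Real.sSup_le ?_ (by positivity)
  rintro _ ⟨c, hc, rfl⟩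
  refine (norm_gcdForm_le _ n c).trans ?_
  set t : ℝ := V / k with ht
  have ht0 : 0 < t := by positivity
  -- The concave function `m ↦ m^θ` lies below its tangent at `m = t`; the choice `t = V/k` turns
  -- the two resulting terms into `V^θ k^(1-θ)`.
  have hM (i j : Fin k) : gcdMatrix (α * θ) n i j
      ≤ t ^ θ * (1 - θ) + t ^ θ * θ / t * gcdMatrix α n i j := by
    rw [gcdMatrix_mul_exponent]
    have hm := gcdMatrix_nonneg α n i j
    set m := gcdMatrix α n i j
    have hmt : 0 ≤ m / t := by positivity
    have h1 := rpow_one_add_le_one_add_mul_self (s := m / t - 1) (by linarith) hθ0 hθ1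
    rw [add_sub_cancel, Real.div_rpow hm ht0.le, div_le_iff₀ (by positivity)] at h1
    refine h1.trans (le_of_eq ?_)
    field_simp
    ring
  have h1 := sum_norm_mul_norm_le hc
  have h2 := (sum_gcdMatrix_mul_norm_le α n hc).trans h
  calc ∑ i, ∑ j, gcdMatrix (α * θ) n i j * (‖c i‖ * ‖c j‖)
      ≤ ∑ i, ∑ j, (t ^ θ * (1 - θ) * (‖c i‖ * ‖c j‖)
          + t ^ θ * θ / t * (gcdMatrix α n i j * (‖c i‖ * ‖c j‖))) := by
        refine Finset.sum_le_sum fun i _ => Finset.sum_le_sum fun j _ => ?_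
        refine (mul_le_mul_of_nonneg_right (hM i j) (by positivity)).trans_eq (by ring)
    _ = t ^ θ * (1 - θ) * ∑ i, ∑ j, ‖c i‖ * ‖c j‖
          + t ^ θ * θ / t * ∑ i, ∑ j, gcdMatrix α n i j * (‖c i‖ * ‖c j‖) := by
        simp_rw [Finset.sum_add_distrib, ← Finset.mul_sum]
    _ ≤ t ^ θ * (1 - θ) * k + t ^ θ * θ / t * V := by
        have : 0 ≤ 1 - θ := by linarith
        gcongr
    _ = t ^ θ * k := by
        have hVt : V = t * k := by rw [ht]; field_simp
        rw [hVt]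
        field_simp
        ring
    _ = _ := by
        rw [ht, Real.div_rpow hV.le hk0.le, Real.rpow_sub hk0, Real.rpow_one]
        field_simp

theorem one_lt_log_natCast (hk : 3 ≤ k) : 1 < Real.log k := by
  rw [Real.lt_log_iff_exp_lt (by positivity)]
  have : (3 : ℝ) ≤ k := by exact_mod_cast hk
  linarith [Real.exp_one_lt_d9]

end interpolation

/-! ### Exponents at most `1/2`. -/

theorem gcdSpectralNorm_le_of_le_half : ∃ C : ℝ, 0 < C ∧ ∀ α : ℝ, 0 < α → α ≤ 1 / 2 →
    ∀ k : ℕ, 3 ≤ k → ∀ n : Fin k → ℕ, StrictMono n → (∀ i, 1 ≤ n i) →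
      gcdSpectralNorm α n ≤ (k : ℝ) ^ (1 - 2 * α) *
        Real.exp (2 * C * Real.sqrt (Real.log k * Real.log (Real.log k))) := by
  set q : ℝ := Real.log (Real.log (3 : ℕ)) with hq
  have hq0 : 0 < q := Real.log_pos (one_lt_log_natCast le_rfl)
  -- The three summands pay for `L / l`, for the Euler product and for the loss `k^d` in
  -- interpolation; `q` is the least value of `log log k`.
  refine ⟨1 + 2 * (1 / q + 1) + 1 / √q, by positivity, fun α hα hα2 k hk n hn hn0 => ?_⟩
  set L := Real.log k with hL
  have hk0 : (0 : ℝ) < k := by positivity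
  have hL1 : 1 < L := one_lt_log_natCast hk
  have hL0 : 0 < L := by linarith
  set LL := Real.log L with hLL
  have hqLL : q ≤ LL := Real.log_le_log (by linarith [one_lt_log_natCast (le_refl 3)])
    (Real.log_le_log (by norm_num) (by exact_mod_cast hk))
  have hLL0 : 0 < LL := hq0.trans_le hqLL
  have hLLL : LL ≤ L := (Real.log_le_sub_one_of_pos hL0).trans (by linarith)
  set R := √(L * LL) with hR
  have hR0 : 0 < R := Real.sqrt_pos.mpr (by positivity)
  set l := ⌈√(L / LL)⌉₊ with hl
  have hs1 : 1 ≤ √(L / LL) := Real.one_le_sqrt.mpr ((one_le_div hLL0).mpr hLLL)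
  have hl0 : l ≠ 0 := (Nat.ceil_pos.mpr (by linarith)).ne'
  have hl1 : √(L / LL) ≤ l := Nat.le_ceil _
  have hl2 : (l : ℝ) ≤ 2 * √(L / LL) := by
    linarith [Nat.ceil_lt_add_one (show 0 ≤ √(L / LL) by linarith)]
  have hsR : √(L / LL) * LL = R := by
    rw [hR, Real.sqrt_div hL0.le, Real.sqrt_mul hL0.le]
    nth_rw 2 [← Real.mul_self_sqrt hLL0.le]
    have : √LL ≠ 0 := (Real.sqrt_pos.mpr hLL0).ne'
    field_simp
  set d : ℝ := 1 / √L with hd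
  have hsL : 1 < √L := Real.lt_sqrt_of_sq_lt (by linarith)
  have hd0 : 0 < d := by positivity
  have hd1 : d ≤ 1 := (div_le_one (by linarith)).mpr hsL.le
  -- With `y = 0` every prime gets the quadratic exponent, and the sum is at most `log(1 + 1/d) =
  -- log(1 + √L)`. The choice of `l` balances `L / l` against `l log L`.
  obtain ⟨N, hN⟩ := exists_gcdSpectralNorm_le_exp (α := (1 + d) / 2) (by positivity)
    (by omega : 1 ≤ k) hn.injective hn0 hl0 0
  have hz := sum_prime_neg_log_one_sub_rpow_le (σ := 1 + d) (by linarith) (Finset.Ioc 0 N)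
  rw [show 2 * ((1 + d) / 2) = 1 + d by ring] at hN
  have hd' : 1 / (1 + d - 1) = √L := by rw [hd, add_sub_cancel_left, one_div_one_div]
  rw [hd'] at hz
  have hz2 : Real.log (1 + √L) ≤ (1 / q + 1) * LL := by
    have h1 : √L ≤ L := Real.sqrt_le_iff.mpr ⟨hL0.le, by nlinarith⟩
    calc Real.log (1 + √L) ≤ Real.log (2 * L) :=
          Real.log_le_log (by positivity) (by linarith)
      _ = Real.log 2 + LL := Real.log_mul two_ne_zero hL0.ne'
      _ ≤ 1 + LL := by linarith [Real.log_two_lt_d9]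
      _ ≤ LL / q + LL := by
          have : 1 ≤ LL / q := (one_le_div hq0).mpr hqLL
          linarith
      _ = _ := by ring
  set E : ℝ := R + 2 * (1 / q + 1) * R with hE
  have hE0 : 0 ≤ E := by positivity
  have hV : gcdSpectralNorm ((1 + d) / 2) n ≤ Real.exp E := by
    refine hN.trans (Real.exp_le_exp.mpr ?_)
    have h1 : L / l ≤ R := by
      rw [div_le_iff₀ (by positivity)]
      calc L = R * √(L / LL) := by
            rw [← hsR, mul_right_comm, Real.mul_self_sqrt (by positivity)]
            field_simp
        _ ≤ R * l := by gcongr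
    have h2 : l * ∑ p ∈ Finset.Ioc 0 N with p.Prime, -Real.log (1 - (p : ℝ) ^ (-(1 + d)))
        ≤ 2 * (1 / q + 1) * R := by
      calc _ ≤ (2 * √(L / LL)) * ((1 / q + 1) * LL) := by
            refine mul_le_mul hl2 (hz.trans hz2) ?_ (by positivity)
            refine Finset.sum_nonneg fun p hp => ?_
            have h := rpow_neg_mem_Ico (α := 1 + d) (by linarith) (Finset.mem_filter.mp hp).2
            exact h.1.trans (le_neg_log_one_sub h.2)
        _ = 2 * (1 / q + 1) * (√(L / LL) * LL) := by ring
        _ = _ := by rw [hsR]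
    simp only [Finset.Icc_eq_empty_of_lt one_pos.gt, Finset.filter_empty, Finset.sum_empty]
    linarith
  -- Chosen so that `(1 + d)/2 · θ = α`; compared with `2α` it loses at most `d`, costing `L d = √L`
  -- in the exponent.
  set θ : ℝ := 2 * α / (1 + d) with hθ
  have hθ0 : 0 ≤ θ := by positivity
  have hθ1 : θ ≤ 1 := by rw [hθ, div_le_one (by linarith)]; linarith
  have hθ2 : 2 * α - d ≤ θ := by
    rw [hθ, le_div_iff₀ (by linarith)]
    nlinarith
  have hα' : (1 + d) / 2 * θ = α := by rw [hθ]; field_simp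
  have h := gcdSpectralNorm_mul_le (by omega : 1 ≤ k) hθ0 hθ1 (Real.exp_pos E) hV
  rw [hα'] at h
  refine h.trans ?_
  rw [← Real.exp_mul, Real.rpow_def_of_pos hk0, Real.rpow_def_of_pos hk0, ← Real.exp_add,
    ← Real.exp_add]
  refine Real.exp_le_exp.mpr ?_
  have h1 : E * θ ≤ E := mul_le_of_le_one_right hE0 hθ1
  have h2 : L * (1 - θ) ≤ L * (1 - 2 * α) + L * d := by nlinarith
  have h3 : L * d = √L := by
    rw [hd, mul_one_div, Real.div_sqrt]
  have h4 : √L ≤ 1 / √q * R := by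
    rw [hR, Real.sqrt_mul hL0.le, one_div, ← div_eq_inv_mul,
      le_div_iff₀ (Real.sqrt_pos.mpr hq0)]
    gcongr
  have h5 : 0 ≤ (1 + 2 * (1 / q + 1) + 1 / √q) * R := by positivity
  calc E * θ + L * (1 - θ) ≤ E + (L * (1 - 2 * α) + 1 / √q * R) := by linarith
    _ = L * (1 - 2 * α) + (1 + 2 * (1 / q + 1) + 1 / √q) * R := by rw [hE]; ring
    _ ≤ _ := by linarith

/-! ### Exponents strictly between `1/2` and `1`. -/

/-- The threshold `3/4` exceeds `2^(-1/2)`, which bounds `p^(-α)` for all primes when `α ≥ 1/2`;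
there `x/(1-x) ≤ 4x`. -/
theorem neg_log_one_sub_le {x : ℝ} (hx0 : 0 ≤ x) (hx : x ≤ 3 / 4) :
    -Real.log (1 - x) ≤ 4 * x := by
  have h1 := Real.log_le_sub_one_of_pos (show 0 < (1 - x)⁻¹ from inv_pos.mpr (by linarith))
  rw [Real.log_inv] at h1
  refine h1.trans ?_
  have h2 : (1 - x)⁻¹ - 1 = x / (1 - x) := by
    have : (1 - x) ≠ 0 := by linarith
    field_simp
    ring
  rw [h2, div_le_iff₀ (by linarith)]
  nlinarith

theorem natCast_rpow_neg_le_of_half_le {p : ℕ} (hp : p.Prime) {α : ℝ} (hα : 1 / 2 ≤ α) :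
    (p : ℝ) ^ (-α) ≤ 3 / 4 := by
  have hp2 : (2 : ℝ) ≤ p := by exact_mod_cast hp.two_le
  calc (p : ℝ) ^ (-α) ≤ (p : ℝ) ^ (-(1 / 2) : ℝ) :=
        Real.rpow_le_rpow_of_exponent_le (by linarith) (by linarith)
    _ ≤ (2 : ℝ) ^ (-(1 / 2) : ℝ) := Real.rpow_le_rpow_of_nonpos two_pos hp2 (by norm_num)
    _ = (√2)⁻¹ := by rw [Real.rpow_neg two_pos.le, Real.sqrt_eq_rpow]
    _ ≤ 3 / 4 := by
        rw [inv_le_comm₀ (by positivity) (by norm_num)]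
        exact Real.le_sqrt_of_sq_le (by norm_num)

theorem log_one_add_div_one_sub_le {x : ℝ} (hx0 : 0 ≤ x) (hx : x ≤ 3 / 4) :
    Real.log ((1 + x) / (1 - x)) ≤ 5 * x := by
  rw [Real.log_div (by linarith) (by linarith)]
  linarith [Real.log_le_sub_one_of_pos (show 0 < 1 + x by linarith), neg_log_one_sub_le hx0 hx]

/-- Chebyshev's bound for the sum of `p ^ (-s)` over the primes up to `y`. -/
theorem sum_prime_rpow_neg_le {s : ℝ} (hs0 : 0 < s) (hs : s < 1) {y : ℕ} (hy : 2 ≤ y) :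
    ∑ p ∈ Finset.Icc 1 y with p.Prime, (p : ℝ) ^ (-s)
      ≤ (2 / (1 - s) ^ 2 + 2 * Real.log 4 / (1 - s)) * ((y : ℝ) ^ (1 - s) / Real.log y) := by
  have hs1 : 0 < 1 - s := by linarith
  have hy2 : (2 : ℝ) ≤ y := by exact_mod_cast hy
  have hy0 : (0 : ℝ) < y := by linarith
  have hlog : 0 < Real.log y := Real.log_pos (by linarith)
  set A := (Finset.Icc 1 y).filter Nat.Prime with hA
  -- Cut at `√y`: below it, all integers are summed, which is already of smaller order; above it,
  -- `log p ≥ (log y)/2` recovers the factor `1 / log y`.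
  have h1 : ∑ p ∈ A with p ≤ Nat.sqrt y, (p : ℝ) ^ (-s)
      ≤ (y : ℝ) ^ ((1 - s) / 2) / (1 - s) := by
    calc _ ≤ ∑ p ∈ Finset.Icc 1 (Nat.sqrt y), (p : ℝ) ^ (-s) := by
          refine Finset.sum_le_sum_of_subset_of_nonneg (fun p hp => ?_) fun p _ _ => by positivity
          rw [Finset.mem_filter, hA, Finset.mem_filter, Finset.mem_Icc] at hp
          exact Finset.mem_Icc.mpr ⟨hp.1.1.1, hp.2⟩
      _ ≤ (Nat.sqrt y : ℝ) ^ (1 - s) / (1 - s) := sum_Icc_rpow_neg_le hs0 hs _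
      _ ≤ (√y) ^ (1 - s) / (1 - s) := by
          gcongr
          exact Real.nat_sqrt_le_real_sqrt
      _ = _ := by
          rw [Real.sqrt_eq_rpow, ← Real.rpow_mul hy0.le]
          ring_nf
  have h2 : ∑ p ∈ A with ¬ p ≤ Nat.sqrt y, (p : ℝ) ^ (-s)
      ≤ 2 / Real.log y * (Real.log 4 / (1 - s) * (y : ℝ) ^ (1 - s)) := by
    calc _ ≤ ∑ p ∈ A with ¬ p ≤ Nat.sqrt y, 2 / Real.log y * (Real.log p * (p : ℝ) ^ (-s)) := by
          refine Finset.sum_le_sum fun p hp => ?_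
          rw [Finset.mem_filter, not_le, Nat.sqrt_lt'] at hp
          have hp0 : (0 : ℝ) < p := by
            exact_mod_cast (Finset.mem_filter.mp hp.1).2.pos
          have h3 : Real.log y ≤ 2 * Real.log p := by
            have := Real.log_le_log hy0 (show (y : ℝ) ≤ (p : ℝ) ^ 2 by exact_mod_cast hp.2.le)
            rwa [Real.log_pow] at this
          rw [← mul_assoc]
          refine le_mul_of_one_le_left (by positivity) ?_
          rw [div_mul_eq_mul_div]
          exact (one_le_div hlog).mpr h3
      _ ≤ ∑ p ∈ A, 2 / Real.log y * (Real.log p * (p : ℝ) ^ (-s)) :=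
          Finset.sum_le_sum_of_subset_of_nonneg (Finset.filter_subset _ _) fun p _ _ =>
            mul_nonneg (by positivity)
              (mul_nonneg (Real.log_natCast_nonneg p) (by positivity))
      _ ≤ _ := by
          rw [← Finset.mul_sum]
          exact mul_le_mul_of_nonneg_left (sum_prime_Icc_log_mul_rpow_neg_le hs0 hs y)
            (by positivity)
  have h3 : (y : ℝ) ^ ((1 - s) / 2) / (1 - s)
      ≤ 2 / (1 - s) ^ 2 * ((y : ℝ) ^ (1 - s) / Real.log y) := by
    have h4 := Real.log_le_rpow_div hy0.le (show 0 < (1 - s) / 2 by positivity)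
    have h5 : (y : ℝ) ^ (1 - s) = (y : ℝ) ^ ((1 - s) / 2) * (y : ℝ) ^ ((1 - s) / 2) := by
      rw [← Real.rpow_add hy0]; ring_nf
    have hY : 0 < (y : ℝ) ^ ((1 - s) / 2) := by positivity
    rw [h5]
    set Y := (y : ℝ) ^ ((1 - s) / 2)
    rw [div_mul_div_comm, div_le_div_iff₀ hs1 (by positivity)]
    have h6 : Real.log y * (1 - s) ≤ 2 * Y := by
      rw [le_div_iff₀ (by positivity)] at h4
      linarith
    calc Y * ((1 - s) ^ 2 * Real.log y) = Y * (1 - s) * (Real.log y * (1 - s)) := by ring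
      _ ≤ Y * (1 - s) * (2 * Y) := by gcongr
      _ = _ := by ring
  rw [← Finset.sum_filter_add_sum_filter_not A (fun p => p ≤ Nat.sqrt y)]
  calc _ ≤ 2 / (1 - s) ^ 2 * ((y : ℝ) ^ (1 - s) / Real.log y)
        + 2 / Real.log y * (Real.log 4 / (1 - s) * (y : ℝ) ^ (1 - s)) :=
        add_le_add (h1.trans h3) h2
    _ = _ := by ring

theorem sum_prime_Ioc_rpow_neg_le {s : ℝ} (hs : 1 < s) {y : ℕ} (hy : 2 ≤ y) (N : ℕ) :
    ∑ p ∈ Finset.Ioc y N with p.Prime, (p : ℝ) ^ (-s)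
      ≤ Real.log 4 * (s / (s - 1)) * ((y : ℝ) ^ (1 - s) / Real.log y) := by
  have hlog : 0 < Real.log y := Real.log_pos (by exact_mod_cast hy)
  rw [← mul_div_assoc, le_div_iff₀ hlog]
  refine le_trans ?_ (sum_prime_Ioc_log_mul_rpow_neg_le (N := N) hs (by omega : 1 ≤ y))
  rw [Finset.sum_mul]
  refine Finset.sum_le_sum fun p hp => ?_
  rw [mul_comm]
  refine mul_le_mul_of_nonneg_right (Real.log_le_log (by positivity) ?_) (by positivity)
  exact_mod_cast (Finset.mem_Ioc.mp (Finset.mem_filter.mp hp).1).1.le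

theorem gcdSpectralNorm_le_of_half_lt {α : ℝ} (hα : 1 / 2 < α) (hα1 : α < 1) :
    ∃ C : ℝ, 0 < C ∧ ∀ k : ℕ, 3 ≤ k → ∀ n : Fin k → ℕ, StrictMono n → (∀ i, 1 ≤ n i) →
      gcdSpectralNorm α n ≤ Real.exp (2 * C *
        ((Real.log k) ^ (1 - α) / (Real.log (Real.log k)) ^ α)) := by
  have hs1 : 0 < 1 - α := by linarith
  have hs2 : 0 < 2 * α - 1 := by linarith
  have hlog4 : 0 < Real.log 4 := Real.log_pos (by norm_num)
  set C₁ := 2 / (1 - α) ^ 2 + 2 * Real.log 4 / (1 - α) with hC₁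
  set C₂ := Real.log 4 * (2 * α / (2 * α - 1)) with hC₂
  have hC₁0 : 0 < C₁ := by positivity
  have hC₂0 : 0 < C₂ := by positivity
  refine ⟨3 + 10 * C₁ + 8 * C₂, by positivity, fun k hk n hn hn0 => ?_⟩
  set L := Real.log k with hL
  have hk0 : (0 : ℝ) < k := by positivity
  have hL1 : 1 < L := one_lt_log_natCast hk
  have hL0 : 0 < L := by linarith
  set LL := Real.log L with hLL
  have hLL0 : 0 < LL := Real.log_pos hL1
  set E := L ^ (1 - α) / LL ^ α with hE
  have hE0 : 0 < E := by positivity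
  rcases le_total LL 1 with hLL1 | hLL1
  -- Here `log k ≤ e < 3` and `E ≥ 1`, so the trivial bound `k` is enough; the summand `3` in the
  -- constant covers it.
  · refine (gcdSpectralNorm_le_card (by linarith) hn0).trans ?_
    rw [← Real.exp_log hk0]
    refine Real.exp_le_exp.mpr ?_
    have h1 : L ≤ Real.exp 1 := by rwa [← Real.log_le_iff_le_exp hL0]
    have h2 : 1 ≤ E := by
      rw [hE, one_le_div (by positivity)]
      exact (Real.rpow_le_one hLL0.le hLL1 (by linarith)).trans
        (Real.one_le_rpow hL1.le hs1.le)
    have h3 := Real.exp_one_lt_d9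
    change L ≤ _
    nlinarith
  set T := L * LL with hT
  have hTL : L ≤ T := le_mul_of_one_le_right hL0.le hLL1
  have hL2 : 2 ≤ L := by
    have h1 : Real.exp 1 ≤ L := by rwa [← Real.le_log_iff_exp_le hL0]
    linarith [Real.add_one_le_exp (1 : ℝ)]
  have hT0 : 0 < T := by linarith
  set y := ⌈T⌉₊ with hy
  have hy1 : T ≤ y := Nat.le_ceil _
  have hy2 : (y : ℝ) ≤ 2 * T := by linarith [Nat.ceil_lt_add_one hT0.le]
  have hy0 : (0 : ℝ) < y := by linarith
  have hy' : 2 ≤ y := by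
    have : (2 : ℝ) ≤ y := by linarith
    exact_mod_cast this
  have hlogy : LL ≤ Real.log y := Real.log_le_log hL0 (hTL.trans hy1)
  set l := ⌈T ^ α⌉₊ with hl
  have hTα : 1 ≤ T ^ α := Real.one_le_rpow (by linarith) (by linarith)
  have hl0 : l ≠ 0 := (Nat.ceil_pos.mpr (by linarith)).ne'
  have hl1 : T ^ α ≤ l := Nat.le_ceil _
  have hl2 : (l : ℝ) ≤ 2 * T ^ α := by
    linarith [Nat.ceil_lt_add_one (show 0 ≤ T ^ α by linarith)]
  -- With `y ≈ T` and `l ≈ T^α`, each of the three terms is at most a constant times this quantity.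
  have hTE : T ^ (1 - α) / LL = E := by
    rw [hT, Real.mul_rpow hL0.le hLL0.le, Real.rpow_sub hLL0, Real.rpow_one, hE]
    field_simp
  obtain ⟨N, hN⟩ := exists_gcdSpectralNorm_le_exp (α := α) (by linarith)
    (by omega : 1 ≤ k) hn.injective hn0 hl0 y
  refine hN.trans (Real.exp_le_exp.mpr ?_)
  have h1 : L / l ≤ E := by
    have : L / T ^ α = E := by
      rw [hT, Real.mul_rpow hL0.le hLL0.le, hE, Real.rpow_sub hL0, Real.rpow_one]
      field_simp
    rw [← this]
    gcongr
  have h2 : ∑ p ∈ Finset.Icc 1 y with p.Prime,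
      Real.log ((1 + (p : ℝ) ^ (-α)) / (1 - (p : ℝ) ^ (-α))) ≤ 10 * C₁ * E := by
    calc _ ≤ ∑ p ∈ Finset.Icc 1 y with p.Prime, 5 * (p : ℝ) ^ (-α) :=
          Finset.sum_le_sum fun p hp => log_one_add_div_one_sub_le (by positivity)
            (natCast_rpow_neg_le_of_half_le (Finset.mem_filter.mp hp).2 hα.le)
      _ ≤ 5 * (C₁ * ((y : ℝ) ^ (1 - α) / Real.log y)) := by
          rw [← Finset.mul_sum]
          gcongr
          exact sum_prime_rpow_neg_le (by linarith) hα1 hy'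
      _ ≤ 5 * (C₁ * (2 * T ^ (1 - α) / LL)) := by
          have h3 : (y : ℝ) ^ (1 - α) ≤ 2 * T ^ (1 - α) := by
            calc (y : ℝ) ^ (1 - α) ≤ (2 * T) ^ (1 - α) := by gcongr
              _ = 2 ^ (1 - α) * T ^ (1 - α) := Real.mul_rpow two_pos.le hT0.le
              _ ≤ 2 * T ^ (1 - α) := by
                  gcongr
                  exact Real.rpow_le_self_of_one_le one_le_two (by linarith)
          gcongr
      _ = 10 * C₁ * (T ^ (1 - α) / LL) := by ring
      _ = _ := by rw [hTE]
  have h3 : l * ∑ p ∈ Finset.Ioc y N with p.Prime, -Real.log (1 - (p : ℝ) ^ (-(2 * α)))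
      ≤ 8 * C₂ * E := by
    calc _ ≤ l * ∑ p ∈ Finset.Ioc y N with p.Prime, 4 * (p : ℝ) ^ (-(2 * α)) := by
          gcongr with p hp
          exact neg_log_one_sub_le (by positivity)
            (natCast_rpow_neg_le_of_half_le (Finset.mem_filter.mp hp).2 (by linarith))
      _ ≤ (2 * T ^ α) * (4 * (C₂ * (T ^ (1 - 2 * α) / LL))) := by
          rw [← Finset.mul_sum]
          gcongr
          refine (sum_prime_Ioc_rpow_neg_le (by linarith) hy' N).trans ?_
          refine mul_le_mul_of_nonneg_left ?_ hC₂0.le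
          exact div_le_div₀ (by positivity)
            (Real.rpow_le_rpow_of_nonpos hT0 hy1 (by linarith)) hLL0 hlogy
      _ = 8 * C₂ * ((T ^ α * T ^ (1 - 2 * α)) / LL) := by ring
      _ = _ := by
          rw [← Real.rpow_add hT0, show α + (1 - 2 * α) = 1 - α by ring, hTE]
  have h4 : 0 ≤ C₁ * E := by positivity
  have h5 : 0 ≤ C₂ * E := by positivity
  linarith

/-! ### Exponent one: the sharp constant. -/

theorem tendsto_sum_prime_log_one_sub_inv_sq :
    Tendsto (fun N : ℕ => ∑ p ∈ Finset.Icc 1 N with p.Prime, Real.log (1 - (p : ℝ) ^ (-2 : ℝ)))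
      atTop (𝓝 (Real.log (6 / Real.pi ^ 2))) := by
  let f : ℕ →*₀ ℝ :=
    { toFun := fun n => (n : ℝ) ^ (-2 : ℝ)
      map_zero' := by simp
      map_one' := by simp
      map_mul' := fun m n => by
        push_cast
        exact Real.mul_rpow m.cast_nonneg n.cast_nonneg }
  have hf (n : ℕ) : f n = 1 / (n : ℝ) ^ 2 := by
    change (n : ℝ) ^ (-2 : ℝ) = _
    rw [Real.rpow_neg n.cast_nonneg, Real.rpow_two, one_div]
  have hz : HasSum (fun n => f n) (Real.pi ^ 2 / 6) := hasSum_zeta_two.congr_fun hf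
  have h := EulerProduct.eulerProduct_completely_multiplicative (f := f) hz.summable.norm
  rw [hz.tsum_eq] at h
  have h1 := ((h.comp (tendsto_add_atTop_nat 1)).log (by positivity)).neg
  have h2 : -Real.log (Real.pi ^ 2 / 6) = Real.log (6 / Real.pi ^ 2) := by
    rw [← Real.log_inv, inv_div]
  rw [h2] at h1
  refine h1.congr fun N => ?_
  have hlt {p : ℕ} (hp : p.Prime) : 0 < 1 - f p := by
    have := (rpow_neg_mem_Ico two_pos hp).2
    exact sub_pos.mpr this
  change -Real.log (∏ p ∈ Nat.primesLE N, (1 - f p)⁻¹) = _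
  rw [Nat.primesLE_eq_filter_Icc_one, Real.log_prod fun p hp =>
    (inv_pos.mpr (hlt (Finset.mem_filter.mp hp).2)).ne', ← Finset.sum_neg_distrib]
  exact Finset.sum_congr rfl fun p _ => by rw [Real.log_inv, neg_neg]; rfl

/-- The length of the interval, on the logarithmic scale, of the primes treated individually. -/
noncomputable def primeScale (u : ℝ) : ℕ := ⌈u + 2 * Real.log u⌉₊ + 1

/-- The logarithm of the bound for the spectral norm of exponent one, divided by `u ^ 2`, at
`u = log (log k)`. -/
noncomputable def logBound (u : ℝ) : ℝ :=
  1 / u + ∑ p ∈ Finset.Icc 1 ⌊Real.exp (primeScale u)⌋₊ with p.Prime,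
      Real.log (1 - (p : ℝ) ^ (-2 : ℝ))
    + 2 * ((harmonic (primeScale u) : ℝ) - Real.log (primeScale u))
    + 2 * ((4 + 11 * Real.log 4) / primeScale u) + 2 * Real.log (primeScale u / u)
    + (8 / u + 8 / (Real.exp u * u ^ 2))

theorem tendsto_primeScale : Tendsto primeScale atTop atTop := by
  have h : Tendsto (fun u : ℝ => ⌈u⌉₊) atTop atTop := tendsto_nat_ceil_atTop
  refine tendsto_atTop_mono' atTop ?_ h
  filter_upwards [eventually_ge_atTop 1] with u hu
  have := Nat.ceil_mono (show u ≤ u + 2 * Real.log u by linarith [Real.log_nonneg hu])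
  unfold primeScale
  omega

theorem tendsto_primeScale_div : Tendsto (fun u => (primeScale u : ℝ) / u) atTop (𝓝 1) := by
  have h0 : Tendsto (fun u : ℝ => Real.log u / u) atTop (𝓝 0) :=
    Real.isLittleO_log_id_atTop.tendsto_div_nhds_zero
  have h1 : Tendsto (fun u : ℝ => 2 / u) atTop (𝓝 0) := tendsto_const_nhds.div_atTop tendsto_id
  have h2 : Tendsto (fun u : ℝ => 1 + 2 * (Real.log u / u) + 2 / u) atTop (𝓝 1) := by
    simpa using ((h0.const_mul 2).const_add 1).add h1
  refine tendsto_of_tendsto_of_tendsto_of_le_of_le' tendsto_const_nhds h2 ?_ ?_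
  · filter_upwards [eventually_ge_atTop 1] with u hu
    rw [one_le_div (by linarith), primeScale]
    push_cast
    linarith [Nat.le_ceil (u + 2 * Real.log u), Real.log_nonneg hu]
  · filter_upwards [eventually_ge_atTop 1] with u hu
    have hu0 : 0 < u := by linarith
    rw [div_le_iff₀ hu0, primeScale]
    have : (1 + 2 * (Real.log u / u) + 2 / u) * u = u + 2 * Real.log u + 2 := by field_simp
    rw [this]
    push_cast
    linarith [Nat.ceil_lt_add_one (show 0 ≤ u + 2 * Real.log u by linarith [Real.log_nonneg hu])]

theorem tendsto_logBound : Tendsto logBound atTop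
    (𝓝 (Real.log (6 / Real.pi ^ 2) + 2 * Real.eulerMascheroniConstant)) := by
  have hT : Tendsto (fun u => (primeScale u : ℝ)) atTop atTop :=
    tendsto_natCast_atTop_atTop.comp tendsto_primeScale
  have a1 : Tendsto (fun u : ℝ => 1 / u) atTop (𝓝 0) := tendsto_const_nhds.div_atTop tendsto_id
  have a2 := tendsto_sum_prime_log_one_sub_inv_sq.comp
    (tendsto_nat_floor_atTop.comp (Real.tendsto_exp_atTop.comp hT))
  have a3 := (Real.tendsto_harmonic_sub_log.comp tendsto_primeScale).const_mul 2
  have a4 : Tendsto (fun u => 2 * ((4 + 11 * Real.log 4) / (primeScale u : ℝ))) atTop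
      (𝓝 (2 * 0)) := (tendsto_const_nhds.div_atTop hT).const_mul 2
  have a5 := (tendsto_primeScale_div.log one_ne_zero).const_mul 2
  have a6 : Tendsto (fun u : ℝ => 8 / u) atTop (𝓝 0) := tendsto_const_nhds.div_atTop tendsto_id
  have a7 : Tendsto (fun u : ℝ => 8 / (Real.exp u * u ^ 2)) atTop (𝓝 0) :=
    tendsto_const_nhds.div_atTop
      (Real.tendsto_exp_atTop.atTop_mul_atTop₀ (tendsto_pow_atTop two_ne_zero))
  have h := ((((a1.add a2).add a3).add a4).add a5).add (a6.add a7)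
  simp only [zero_add, mul_zero, add_zero, Real.log_one] at h
  exact h

theorem gcdSpectralNorm_one_le {k : ℕ} (hk : 3 ≤ k) {n : Fin k → ℕ} (hn : StrictMono n)
    (hn0 : ∀ i, 1 ≤ n i) : gcdSpectralNorm 1 n
      ≤ Real.exp (logBound (Real.log (Real.log k))) * (Real.log (Real.log k)) ^ 2 := by
  set L := Real.log k with hL
  have hL1 : 1 < L := one_lt_log_natCast hk
  have hL0 : 0 < L := by linarith
  set u := Real.log L with hu
  have hu0 : 0 < u := Real.log_pos hL1
  have hLu : L = Real.exp u := (Real.exp_log hL0).symm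
  set T := primeScale u with hT
  -- The `+ 1` in `primeScale` matters for small `k`: there `u + 2 log u` is negative and its
  -- ceiling is `0`.
  have hT1 : 1 ≤ T := by rw [hT, primeScale]; omega
  have hT0 : (0 : ℝ) < T := by exact_mod_cast hT1
  set y := ⌊Real.exp T⌋₊ with hy
  have hy1 : 1 ≤ y := one_le_floor_exp hT0.le
  have hy1' : (1 : ℝ) ≤ y := by exact_mod_cast hy1
  have hy2 : Real.exp u * u ^ 2 ≤ 2 * y := by
    calc Real.exp u * u ^ 2 = Real.exp (u + 2 * Real.log u) := by
          rw [Real.exp_add, mul_comm 2, Real.exp_mul, Real.exp_log hu0, Real.rpow_two]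
      _ ≤ Real.exp T := by
          refine Real.exp_le_exp.mpr ?_
          rw [hT, primeScale]
          push_cast
          linarith [Nat.le_ceil (u + 2 * Real.log u)]
      _ ≤ y + 1 := (Nat.lt_floor_add_one _).le
      _ ≤ 2 * y := by linarith
  -- Thus `L / l ≤ 1/u`, while `y ≥ L u² / 2` makes the tail `l · 4/y` of order `1/u`.
  set l := ⌈L * u⌉₊ with hl
  have hl0 : l ≠ 0 := (Nat.ceil_pos.mpr (by positivity)).ne'
  have hl1 : L * u ≤ l := Nat.le_ceil _
  have hl2 : (l : ℝ) ≤ L * u + 1 := (Nat.ceil_lt_add_one (by positivity)).le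
  obtain ⟨N, hN⟩ := exists_gcdSpectralNorm_le_exp one_pos (by omega : 1 ≤ k) hn.injective hn0
    hl0 y
  have e : u ^ 2 = Real.exp (2 * Real.log u) := by
    rw [mul_comm, Real.exp_mul, Real.exp_log hu0, Real.rpow_two]
  refine hN.trans ?_
  rw [e, ← Real.exp_add]
  refine Real.exp_le_exp.mpr ?_
  have h1 : L / l ≤ 1 / u := by
    rw [div_le_div_iff₀ (by positivity) hu0]
    linarith
  -- From `(1+x)/(1-x) = (1-x²)/(1-x)²`: the first factor leads to `1/ζ(2)`, the second to the
  -- square of Mertens' product.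
  have h2 : ∑ p ∈ Finset.Icc 1 y with p.Prime,
        Real.log ((1 + (p : ℝ) ^ (-1 : ℝ)) / (1 - (p : ℝ) ^ (-1 : ℝ)))
      = ∑ p ∈ Finset.Icc 1 y with p.Prime, Real.log (1 - (p : ℝ) ^ (-2 : ℝ))
        + 2 * ∑ p ∈ Finset.Icc 1 y with p.Prime, -Real.log (1 - 1 / (p : ℝ)) := by
    rw [Finset.mul_sum, ← Finset.sum_add_distrib]
    refine Finset.sum_congr rfl fun p hp => ?_
    obtain ⟨h0, h1⟩ := rpow_neg_mem_Ico one_pos (Finset.mem_filter.mp hp).2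
    have h3 : (p : ℝ) ^ (-2 : ℝ) = (p : ℝ) ^ (-1 : ℝ) * (p : ℝ) ^ (-1 : ℝ) := by
      rw [← sq, ← Real.rpow_mul_natCast p.cast_nonneg]
      norm_num
    have h4 : 1 / (p : ℝ) = (p : ℝ) ^ (-1 : ℝ) := by rw [Real.rpow_neg_one, one_div]
    rw [h3, h4]
    set x := (p : ℝ) ^ (-1 : ℝ)
    rw [Real.log_div (by linarith) (by linarith), show 1 - x * x = (1 + x) * (1 - x) by ring,
      Real.log_mul (by linarith) (by linarith)]
    ring
  have h3 := sum_prime_neg_log_one_sub_inv_le hT1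
  have h4 : ∑ m ∈ Finset.Icc 1 T, 1 / (m : ℝ) = (harmonic T : ℝ) := by
    rw [harmonic_eq_sum_Icc]
    push_cast
    simp [one_div]
  have h5 : l * ∑ p ∈ Finset.Ioc y N with p.Prime, -Real.log (1 - (p : ℝ) ^ (-(2 * 1) : ℝ))
      ≤ 8 / u + 8 / (Real.exp u * u ^ 2) := by
    have h6 : ∑ p ∈ Finset.Ioc y N with p.Prime, -Real.log (1 - (p : ℝ) ^ (-(2 * 1) : ℝ))
        ≤ 4 * (1 / y) := by
      calc _ ≤ ∑ p ∈ Finset.Ioc y N with p.Prime, 4 * (p : ℝ) ^ (-2 : ℝ) := by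
            rw [mul_one]
            exact Finset.sum_le_sum fun p hp => neg_log_one_sub_le (by positivity)
              (natCast_rpow_neg_le_of_half_le (Finset.mem_filter.mp hp).2 (by norm_num))
        _ ≤ ∑ p ∈ Finset.Ioc y N, 4 * (p : ℝ) ^ (-2 : ℝ) :=
            Finset.sum_le_sum_of_subset_of_nonneg (Finset.filter_subset _ _)
              fun p _ _ => by positivity
        _ ≤ _ := by
            rw [← Finset.mul_sum]
            refine mul_le_mul_of_nonneg_left ((sum_Ioc_rpow_neg_le one_lt_two hy1).trans_eq ?_)
              (by norm_num)
            rw [show (1 : ℝ) - 2 = -1 by norm_num, Real.rpow_neg_one]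
            norm_num
    calc _ ≤ (L * u + 1) * (4 * (2 / (Real.exp u * u ^ 2))) := by
          refine mul_le_mul hl2 (h6.trans (mul_le_mul_of_nonneg_left ?_ (by norm_num))) ?_
            (by positivity)
          · rw [div_le_div_iff₀ (by linarith) (by positivity)]
            linarith
          · refine Finset.sum_nonneg fun p hp => ?_
            have h := rpow_neg_mem_Ico (α := 2 * 1) (by norm_num) (Finset.mem_filter.mp hp).2
            exact h.1.trans (le_neg_log_one_sub h.2)
      _ = _ := by
          rw [hLu]
          field_simp
          ring
  rw [h4] at h3
  rw [h2]
  have h7 : Real.log (T / u) = Real.log T - Real.log u := Real.log_div hT0.ne' hu0.ne'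
  unfold logBound
  rw [← hT, ← hy, h7]
  linarith

/-! ### Assembly of the three ranges. -/

theorem theorem2 :
    (∃ δ : ℕ → ℝ, Tendsto δ atTop (𝓝 0) ∧
      ∀ (k : ℕ), 3 ≤ k → ∀ (n : Fin k → ℕ), StrictMono n → (∀ i, 1 ≤ n i) →
        gcdSpectralNorm 1 n ≤
          (6 * Real.exp (2 * Real.eulerMascheroniConstant) / Real.pi ^ 2 + δ k) *
            (Real.log (Real.log (k : ℝ))) ^ 2) ∧
    (∃ C : ℝ → ℝ, (∀ α : ℝ, 0 < C α) ∧
      (∀ α : ℝ, 1 / 2 < α → α < 1 →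
        ∀ (k : ℕ), 3 ≤ k → ∀ (n : Fin k → ℕ), StrictMono n → (∀ i, 1 ≤ n i) →
          gcdSpectralNorm α n ≤
            Real.exp (2 * C α *
              ((Real.log (k : ℝ)) ^ (1 - α) / (Real.log (Real.log (k : ℝ))) ^ α))) ∧
      (∀ α : ℝ, 0 < α → α ≤ 1 / 2 →
        ∀ (k : ℕ), 3 ≤ k → ∀ (n : Fin k → ℕ), StrictMono n → (∀ i, 1 ≤ n i) →
          gcdSpectralNorm α n ≤
            (k : ℝ) ^ (1 - 2 * α) *
              Real.exp (2 * C α *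
                Real.sqrt (Real.log (k : ℝ) * Real.log (Real.log (k : ℝ)))))) := by
  constructor
  · refine ⟨fun k => Real.exp (logBound (Real.log (Real.log k)))
      - 6 * Real.exp (2 * Real.eulerMascheroniConstant) / Real.pi ^ 2, ?_,
      fun k hk n hn hn0 => ?_⟩
    · have hLL : Tendsto (fun k : ℕ => Real.log (Real.log k)) atTop atTop :=
        Real.tendsto_log_atTop.comp (Real.tendsto_log_atTop.comp tendsto_natCast_atTop_atTop)
      have h := (Real.continuous_exp.tendsto _).comp (tendsto_logBound.comp hLL)
      rw [Real.exp_add, Real.exp_log (by positivity), div_mul_eq_mul_div] at h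
      have h' := h.sub_const (6 * Real.exp (2 * Real.eulerMascheroniConstant) / Real.pi ^ 2)
      rwa [sub_self] at h'
    · rw [add_sub_cancel]
      exact gcdSpectralNorm_one_le hk hn hn0
  · obtain ⟨C₀, hC₀, h₀⟩ := gcdSpectralNorm_le_of_le_half
    choose! C₁ hC₁ using fun (α : ℝ) (h : 1 / 2 < α ∧ α < 1) =>
      gcdSpectralNorm_le_of_half_lt h.1 h.2
    -- A single constant `C₀` serves all `α ≤ 1/2`; elsewhere outside `(1/2, 1)` it is just a
    -- positive default.
    refine ⟨fun α => if 1 / 2 < α ∧ α < 1 then C₁ α else C₀, fun α => ?_,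
      fun α h1 h2 k hk n hn hn0 => ?_, fun α h1 h2 k hk n hn hn0 => ?_⟩
    · dsimp only
      split_ifs with h
      · exact (hC₁ α h).1
      · exact hC₀
    · simp only [if_pos (⟨h1, h2⟩ : 1 / 2 < α ∧ α < 1)]
      exact (hC₁ α ⟨h1, h2⟩).2 k hk n hn hn0
    · simp only [if_neg (fun h : 1 / 2 < α ∧ α < 1 => absurd h.1 (not_lt.mpr h2))]
      exact h₀ α h1 h2 k hk n hn hn0
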